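/- Let $m,c,\sigma\ge 1$ be integers with $mc\le\sigma$, let $W_0,B_0\ge 0$ be integers with $T_0:=W_0+B_0\ge m$, and put $T_n=T_0+\sigma n$, $\Lambda=\frac{mc}{\sigma}$, $C=\frac{\Lambda\sigma}{m}=c$. Consider the balanced triangular affine urn that starts with $W_0$ white and $B_0$ black balls: at each step a sample of $m$ balls is drawn, either without replacement (model $\mathcal M$) or with replacement (model $\mathcal R$), and is put back; if it contains exactly $k$ white balls, then $kc$ white and $\sigma-kc$ black balls are added. Thus, given the first $n-1$ draws, the $n$-th sample contains $k$ white balls, $0\le k\le m$, with probability $\binom{W_{n-1}}{k}\binom{B_{n-1}}{m-k}/\binom{T_{n-1}}{m}$ in model $\mathcal M$ and $\binom mk W_{n-1}^kB_{n-1}^{m-k}/T_{n-1}^m$ in model $\mathcal R$, where $W_n$ and $B_n=T_n-W_n$ are the numbers of white and black balls after $n$ draws. For $n\ge1$ and $1\le r\le s$ let $$f_{n,s,r}=\sum_{j=s-r}^{s}\binom sj\frac{\Lambda^j\sigma^j}{m^j}\,p_{n;(j,\,j-(s-r))},\qquad p_{n;(i,\ell)}=\begin{cases}\displaystyle\sum_{h=\ell}^{\min\{i,m\}}(-1)^{h-\ell}\,\frac{{h\brack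 \ell}{i\brace h}\binom mh}{\binom{T_{n-1}}{h}},&\text{model }\mathcal M,\\[2ex] \displaystyle{i\brace \ell}\frac{m(m-1)\cdots(m-\ell+1)}{T_{n-1}^{\ell}},&\text{model }\mathcal R,\end{cases}$$ with the unsigned Stirling numbers of the first kind ${h\brack \ell}$ and those of the second kind ${i\brace h}$, and $f_{0,s,r}=1$. Let $\varphi_{n,s,s}=\prod_{j=1}^nf_{j,s,s}$ and, for $1\le k\le s-1$, $$\varphi_{n,s,k}=\sum_{\ell=1}^{s-k}\ \sum_{\substack{h_1+\dots+h_\ell=s-k\\ h_\nu\ge1}}\ \sum_{1\le i_\ell<\dots<i_1\le n}\ \prod_{g=1}^{\ell+1}\Bigl(f_{i_g,s-H_{g-1},s-H_g}\prod_{j=i_g+1}^{i_{g-1}-1}f_{j,s-H_{g-1},s-H_{g-1}}\Bigr),$$ where $H_g=\sum_{\nu=1}^{\min\{g,\ell\}}h_\nu$, $i_0=n+1$ and $i_{\ell+1}=0$. Then for every integer $s\ge1$ the following holds. 1. For all $n\ge0$, $\displaystyle\mathbb E[W_n^s]=\sum_{k=1}^s\varphi_{n,s,k}W_0^k$. 2.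 For $1\le k\le s$ the limit $\tilde\varphi_{s,k}=\lim_{n\to\infty}\varphi_{n,s,k}/\varphi_{n,s,s}$ exists. One has $\tilde\varphi_{s,s}=1$ and, for $1\le k\le s-1$, $$\tilde\varphi_{s,k}=\sum_{\ell=1}^{s-k}\ \sum_{\substack{h_1+\dots+h_\ell=s-k\\ h_\nu\ge1}}\ \sum_{1\le i_\ell<\dots<i_1<\infty} f_{i_1,s,s-H_1}\,\frac{\prod_{g=2}^{\ell+1}\Bigl(f_{i_g,s-H_{g-1},s-H_g}\prod_{j=i_g+1}^{i_{g-1}-1}f_{j,s-H_{g-1},s-H_{g-1}}\Bigr)}{\prod_{j=1}^{i_1}f_{j,s,s}},$$ where the infinite sums converge (absolutely). 3. The limit $E_s=\lim_{n\to\infty}\mathbb E\bigl[(W_n/n^{\Lambda})^s\bigr]$ exists, and with $s^*=\min\{s,m\}$ $$E_s=\begin{cases}\displaystyle\prod_{\ell=1}^{s^*}\frac{\Gamma\bigl(\frac{T_0+1-\ell}{\sigma}\bigr)}{\Gamma(\lambda_{\ell,s})}\ \sum_{k=1}^s\tilde\varphi_{s,k}W_0^k,&\text{model }\mathcal M,\\[2ex]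 \displaystyle\frac{\Gamma\bigl(\frac{T_0}{\sigma}\bigr)^s}{\prod_{\ell=1}^s\Gamma(\mu_{\ell,s})}\ \sum_{k=1}^s\tilde\varphi_{s,k}W_0^k,&\text{model }\mathcal R,\end{cases}$$ where $\lambda_{1,s},\dots,\lambda_{s^*,s}$ and $\mu_{1,s},\dots,\mu_{s,s}$ are the negatives of the complex roots, with multiplicity, of the monic polynomials $$P_s(x)=\frac{s^*!}{\sigma^{s^*}}\sum_{\ell=0}^{s^*}\frac{\binom s\ell}{\binom{s^*}{\ell}}C^\ell\binom m\ell\binom{x\sigma+T_0-\ell}{s^*-\ell},\qquad Q_s(x)=\frac1{\sigma^s}\sum_{\ell=0}^s\binom s\ell C^\ell\binom m\ell\,\ell!\,(x\sigma+T_0)^{s-\ell}.$$ -/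

import Mathlib

open MeasureTheory ProbabilityTheory Filter Topology Polynomial

noncomputable section

namespace TriangularUrn

/-- The two sampling schemes: model `M` (the `m` balls of a sample are drawn without replacement)
and model `R` (they are drawn with replacement). -/
inductive Model where
  | M
  | R

/-- The first column `a_k = (m - k) c`, `0 ≤ k ≤ m`, of the ball replacement matrix: the number of
white balls added when the sample contains `m - k` white and `k` black balls. -/
def replWhite (m c k : ℕ) : ℕ := (m - k) * c

/-- The second column `b_k = σ - a_k` of the ball replacement matrix (used for `m c ≤ σ` only, so
that the subtraction is never truncated). -/
def replBlack (m c σ k : ℕ) : ℕ := σ - (m - k) * c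

/-- The probability that a sample of size `m` contains exactly `k ≤ m` white balls, when the urn
contains `w` white and `b` black balls. -/
def drawProb (mod : Model) (m w b k : ℕ) : ℝ :=
  match mod with
  | .M => (w.choose k : ℝ) * (b.choose (m - k) : ℝ) / ((w + b).choose m : ℝ)
  | .R => (m.choose k : ℝ) * (w : ℝ) ^ k * (b : ℝ) ^ (m - k) / ((w : ℝ) + (b : ℝ)) ^ m

section Draws

variable {Ω : Type*} {m : ℕ}

/-- `W_n`: the number of white balls after `n` draws; `X i` is the number of white balls in the
sample of draw number `i + 1`. -/
def whiteBalls (c W₀ : ℕ) (X : ℕ → Ω → Fin (m + 1)) (n : ℕ) (ω : Ω) : ℕ :=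
  W₀ + ∑ i ∈ Finset.range n, replWhite m c (m - (X i ω : ℕ))

/-- `B_n`: the number of black balls after `n` draws. -/
def blackBalls (c σ B₀ : ℕ) (X : ℕ → Ω → Fin (m + 1)) (n : ℕ) (ω : Ω) : ℕ :=
  B₀ + ∑ i ∈ Finset.range n, replBlack m c σ (m - (X i ω : ℕ))

/-- The `σ`-algebra generated by the first `n` draws. -/
abbrev history (X : ℕ → Ω → Fin (m + 1)) (n : ℕ) : MeasurableSpace Ω :=
  ⨆ i ∈ Finset.range n, MeasurableSpace.comap (X i) inferInstance

/-- `X` is the sequence of draws of the urn that starts with `W₀` white and `B₀` black balls: given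
the first `n` draws, the next sample is drawn from the current urn according to the model. -/
structure IsUrnProcess [MeasurableSpace Ω] (mod : Model) (c σ W₀ B₀ : ℕ) (P : Measure Ω)
    (X : ℕ → Ω → Fin (m + 1)) : Prop where
  measurable_draw : ∀ n, Measurable (X n)
  draw_law : ∀ (n : ℕ) (k : Fin (m + 1)),
    P[(X n ⁻¹' {k}).indicator (fun _ => (1 : ℝ)) | history X n] =ᵐ[P]
      fun ω => drawProb mod m (whiteBalls c W₀ X n ω) (blackBalls c σ B₀ X n ω) k

end Draws

/-- The urn index `Λ = m (a_{m-1} - a_m) / σ = m c / σ`. -/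
def index (m c σ : ℕ) : ℝ := (m : ℝ) * (c : ℝ) / (σ : ℝ)

/-- `p_{n;(i,ℓ)}` as a function of `T = T_{n-1}`: the coefficient of `w ^ ℓ` in the `i`-th moment of
the number of white balls in a sample of size `m` from `w` white and `T - w` black balls. -/
def pCoeff (mod : Model) (m T i l : ℕ) : ℝ :=
  match mod with
  | .M => ∑ h ∈ Finset.Icc l (min i m),
      (-1 : ℝ) ^ (h - l) * (Nat.stirlingFirst h l : ℝ) * (Nat.stirlingSecond i h : ℝ)
        * (m.choose h : ℝ) / (T.choose h : ℝ)
  | .R => (Nat.stirlingSecond i l : ℝ) * (m.descFactorial l : ℝ) / (T : ℝ) ^ l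

/-- `f_{n,s,r}`, for `n ≥ 1` and `r ≤ s`, with `T_{n-1} = T₀ + σ (n - 1)`; by convention
`f_{0,s,r} = 1`. -/
def fCoeff (mod : Model) (m c σ T₀ : ℕ) (n s r : ℕ) : ℝ :=
  if n = 0 then 1 else
    ∑ j ∈ Finset.Icc (s - r) s,
      (s.choose j : ℝ) * (index m c σ ^ j * (σ : ℝ) ^ j / (m : ℝ) ^ j)
        * pCoeff mod m (T₀ + σ * (n - 1)) j (j - (s - r))

section Paths

/-- All `(h_1, …, h_ℓ)` of integers `h_ν ≥ 1` with sum `N` (`h ν` is `h_{ν+1}`). -/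
def jumpHeights (l N : ℕ) : Finset (Fin l → ℕ) :=
  (Finset.piAntidiag Finset.univ N).filter fun h => ∀ ν, 1 ≤ h ν

/-- `H_g = h_1 + ⋯ + h_g`. -/
def partialHeight {l : ℕ} (h : Fin l → ℕ) (g : ℕ) : ℕ :=
  ∑ ν : Fin l, if (ν : ℕ) < g then h ν else 0

/-- All `(i_1, …, i_ℓ)` with `1 ≤ i_ℓ < ⋯ < i_1 ≤ n` (`i g` is `i_{g+1}`). -/
def jumpTimes (l n : ℕ) : Finset (Fin l → ℕ) :=
  (Fintype.piFinset fun _ => Finset.Icc 1 n).filter fun i => ∀ a b, a < b → i b < i a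

/-- All `(i_1, …, i_ℓ)` with `1 ≤ i_ℓ < ⋯ < i_1 < ∞`. -/
def JumpTimesInf (l : ℕ) : Type :=
  {i : Fin l → ℕ // (∀ a, 1 ≤ i a) ∧ ∀ a b, a < b → i b < i a}

/-- The sequence `i_0, i_1, …, i_ℓ, i_{ℓ+1}` with `i_0 = top` and `i_{ℓ+1} = 0`. -/
def extTimes {l : ℕ} (top : ℕ) (i : Fin l → ℕ) (g : ℕ) : ℕ :=
  if g = 0 then top else if hg : g - 1 < l then i ⟨g - 1, hg⟩ else 0

/-- The factor
`f_{i_g, s-H_{g-1}, s-H_g} * ∏_{j = i_g + 1}^{i_{g-1} - 1} f_{j, s-H_{g-1}, s-H_{g-1}}`. -/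
def stepFactor (f : ℕ → ℕ → ℕ → ℝ) (s : ℕ) {l : ℕ} (h : Fin l → ℕ) (top : ℕ) (i : Fin l → ℕ)
    (g : ℕ) : ℝ :=
  f (extTimes top i g) (s - partialHeight h (g - 1)) (s - partialHeight h g)
    * ∏ j ∈ Finset.Icc (extTimes top i g + 1) (extTimes top i (g - 1) - 1),
        f j (s - partialHeight h (g - 1)) (s - partialHeight h (g - 1))

/-- `φ_{n,s,k}`, `1 ≤ k ≤ s`, for a triple sequence `f`; here `i_0 = n + 1`. -/
def phi (f : ℕ → ℕ → ℕ → ℝ) (n s k : ℕ) : ℝ :=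
  if k = s then ∏ j ∈ Finset.Icc 1 n, f j s s
  else ∑ l ∈ Finset.Icc 1 (s - k), ∑ h ∈ jumpHeights l (s - k), ∑ i ∈ jumpTimes l n,
    ∏ g ∈ Finset.Icc 1 (l + 1), stepFactor f s h (n + 1) i g

/-- The summand of the infinite sum for `φ̃_{s,k}`, with `ℓ ≥ 1`. The value of `i_0` is irrelevant
here, because only the factors with `g ≥ 2` occur. -/
def limitTerm (f : ℕ → ℕ → ℕ → ℝ) (s : ℕ) {l : ℕ} (h : Fin l → ℕ) (i : Fin l → ℕ) : ℝ :=
  f (extTimes 0 i 1) s (s - partialHeight h 1)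
    * (∏ g ∈ Finset.Icc 2 (l + 1), stepFactor f s h 0 i g)
    / ∏ j ∈ Finset.Icc 1 (extTimes 0 i 1), f j s s

/-- The explicit value of `φ̃_{s,k}`, `1 ≤ k ≤ s`. -/
def phiLim (f : ℕ → ℕ → ℕ → ℝ) (s k : ℕ) : ℝ :=
  if k = s then 1
  else ∑ l ∈ Finset.Icc 1 (s - k), ∑ h ∈ jumpHeights l (s - k),
    ∑' i : JumpTimesInf l, limitTerm f s h i.1

end Paths

/-- The binomial coefficient `binom (x σ + t) r` as a polynomial in `x`. -/
def binomPoly (σ : ℕ) (t : ℂ) (r : ℕ) : ℂ[X] :=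
  C (1 / (r.factorial : ℂ)) * ∏ i ∈ Finset.range r, (C (σ : ℂ) * X + C (t - (i : ℂ)))

/-- The polynomial `P_s` (model `M`), with `s^* = min s m` and `C = Λ σ / m`. -/
def polyP (m c σ T₀ s : ℕ) : ℂ[X] :=
  C (((min s m).factorial : ℂ) / (σ : ℂ) ^ (min s m))
    * ∑ l ∈ Finset.range (min s m + 1),
        C ((s.choose l : ℂ) / ((min s m).choose l : ℂ) * ((index m c σ : ℂ) * (σ : ℂ) / (m : ℂ)) ^ l
            * (m.choose l : ℂ))
          * binomPoly σ ((T₀ : ℂ) - (l : ℂ)) (min s m - l)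

/-- The polynomial `Q_s` (model `R`). -/
def polyQ (m c σ T₀ s : ℕ) : ℂ[X] :=
  C (1 / (σ : ℂ) ^ s)
    * ∑ l ∈ Finset.range (s + 1),
        C ((s.choose l : ℂ) * ((index m c σ : ℂ) * (σ : ℂ) / (m : ℂ)) ^ l * (m.choose l : ℂ)
            * (l.factorial : ℂ))
          * (C (σ : ℂ) * X + C (T₀ : ℂ)) ^ (s - l)

/-- The product of `Γ(-ρ)` over all complex roots `ρ` of `p`, with multiplicity. -/
def gammaNegRoots (p : ℂ[X]) : ℂ := (p.roots.map fun ρ => Complex.Gamma (-ρ)).prod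

/-- The Gamma function prefactor of `E_s`. -/
def prefactor (mod : Model) (m c σ T₀ s : ℕ) : ℂ :=
  match mod with
  | .M => (∏ l ∈ Finset.Icc 1 (min s m), Complex.Gamma (((T₀ : ℂ) + 1 - (l : ℂ)) / (σ : ℂ)))
      / gammaNegRoots (polyP m c σ T₀ s)
  | .R => Complex.Gamma ((T₀ : ℂ) / (σ : ℂ)) ^ s / gammaNegRoots (polyQ m c σ T₀ s)

end TriangularUrn

namespace TriangularUrn

theorem drawProb_nonneg (mod : Model) (m w b k : ℕ) : 0 ≤ drawProb mod m w b k := by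
  cases mod <;> simp only [drawProb] <;> positivity

theorem sum_drawProb (mod : Model) {m w b : ℕ} (hm : 1 ≤ m) (h : m ≤ w + b) :
    ∑ k : Fin (m + 1), drawProb mod m w b k = 1 := by
  rw [Fin.sum_univ_eq_sum_range (fun k => drawProb mod m w b k)]
  cases mod with
  | M =>
    simp only [drawProb]
    rw [← Finset.sum_div, div_eq_one_iff_eq]
    · have := Nat.add_choose_eq w b m
      rw [Finset.Nat.sum_antidiagonal_eq_sum_range_succ
        (fun i j => w.choose i * b.choose j) m] at this
      rw [this]; push_cast; rfl
    · exact_mod_cast (Nat.choose_pos h).ne'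
  | R =>
    simp only [drawProb]
    rw [← Finset.sum_div, div_eq_one_iff_eq]
    · rw [add_pow]
      exact Finset.sum_congr rfl fun k _ => by ring
    · have : 0 < (w : ℝ) + b := by exact_mod_cast (by omega : 0 < w + b)
      positivity

/-- A process of draws exists for all admissible parameters, so that `IsUrnProcess` can always be
satisfied. -/
theorem exists_isUrnProcess (mod : Model) {m c σ W₀ B₀ : ℕ} (hm : 1 ≤ m) (hT₀ : m ≤ W₀ + B₀) :
    ∃ (P : Measure (ℕ → Fin (m + 1))) (X : ℕ → (ℕ → Fin (m + 1)) → Fin (m + 1)),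
      IsProbabilityMeasure P ∧ IsUrnProcess mod c σ W₀ B₀ P X := by
  classical
  let ext : (n : ℕ) → ((i : Finset.Iic n) → Fin (m + 1)) → ℕ → Unit → Fin (m + 1) :=
    fun n y i _ => if h : i + 1 ∈ Finset.Iic n then y ⟨i + 1, h⟩ else 0
  let q : (n : ℕ) → ((i : Finset.Iic n) → Fin (m + 1)) → Fin (m + 1) → ℝ := fun n y k =>
    drawProb mod m (whiteBalls c W₀ (ext n y) n ()) (blackBalls c σ B₀ (ext n y) n ()) k
  let κ : (n : ℕ) → Kernel ((i : Finset.Iic n) → Fin (m + 1)) (Fin (m + 1)) := fun n =>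
    { toFun := fun y => ∑ k, ENNReal.ofReal (q n y k) • Measure.dirac k
      measurable' := measurable_of_countable _ }
  have hκ : ∀ n y, κ n y = ∑ k, ENNReal.ofReal (q n y k) • Measure.dirac k := fun n y => rfl
  have hq : ∀ n y, ∑ k, q n y k = 1 := fun n y =>
    sum_drawProb mod hm (by simp only [whiteBalls, blackBalls]; omega)
  have hκ1 : ∀ n, IsMarkovKernel (κ n) := fun n => ⟨fun y => ⟨by
    rw [hκ]
    simp only [Measure.coe_finsetSum, Finset.sum_apply, Measure.smul_apply, measure_univ,
      smul_eq_mul, mul_one]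
    rw [← ENNReal.ofReal_sum_of_nonneg fun k _ => drawProb_nonneg _ _ _ _ _, hq,
      ENNReal.ofReal_one]⟩⟩
  have hκk : ∀ n y k, (κ n y).real {k} = q n y k := fun n y k => by
    rw [measureReal_def, hκ]
    simp only [Measure.coe_finsetSum, Finset.sum_apply, Measure.smul_apply,
      smul_eq_mul, Measure.dirac_apply' _ (measurableSet_singleton k), Set.indicator_apply,
      Set.mem_singleton_iff, Pi.one_apply, mul_ite, mul_one, mul_zero, Finset.sum_ite_eq',
      Finset.mem_univ, if_true]
    exact ENNReal.toReal_ofReal (drawProb_nonneg _ _ _ _ _)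
  let X : ℕ → (ℕ → Fin (m + 1)) → Fin (m + 1) := fun i ω => ω (i + 1)
  have hX : ∀ n, Measurable (X n) := fun n => measurable_pi_apply _
  refine ⟨Kernel.traj (X := fun _ => Fin (m + 1)) κ 0 (fun _ => 0), X, inferInstance, hX, ?_⟩
  intro n k
  have hint : Integrable ((X n ⁻¹' {k}).indicator (fun _ => (1 : ℝ)))
      (Kernel.traj (X := fun _ => Fin (m + 1)) κ 0 (fun _ => 0)) :=
    (integrable_const _).indicator (hX n (measurableSet_singleton k))
  have hle : history X n ≤ Filtration.piLE (X := fun _ : ℕ => Fin (m + 1)) n := by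
    refine iSup₂_le fun i hi => ?_
    rw [Filtration.piLE_eq_comap_frestrictLe]
    have hi' : i + 1 ∈ Finset.Iic n := by
      have := Finset.mem_range.1 hi
      exact Finset.mem_Iic.2 this
    have : X i = (fun y : (j : Finset.Iic n) → Fin (m + 1) => y ⟨i + 1, hi'⟩) ∘
        Preorder.frestrictLe n := rfl
    rw [this, ← MeasurableSpace.comap_comp]
    exact MeasurableSpace.comap_mono (measurable_pi_apply _).comap_le
  have hext : ∀ (ω : ℕ → Fin (m + 1)), ∀ i ∈ Finset.range n,
      ext n (Preorder.frestrictLe (π := fun _ : ℕ => Fin (m + 1)) n ω) i () = X i ω := by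
    intro ω i hi
    have hi' : i + 1 ∈ Finset.Iic n := Finset.mem_Iic.2 (Finset.mem_range.1 hi)
    simp only [ext, hi', dif_pos]
    rfl
  have key := Kernel.condExp_traj (X := fun _ => Fin (m + 1)) (κ := κ) (Nat.zero_le n) hint
  have hval : ∀ ω : ℕ → Fin (m + 1),
      ∫ y, ((X n ⁻¹' {k}).indicator (fun _ => (1 : ℝ))) y
        ∂Kernel.traj (X := fun _ => Fin (m + 1)) κ n (Preorder.frestrictLe n ω)
      = drawProb mod m (whiteBalls c W₀ X n ω) (blackBalls c σ B₀ X n ω) k := by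
    intro ω
    refine (integral_indicator_one (hX n (measurableSet_singleton k))).trans ?_
    have h1 : (κ n (Preorder.frestrictLe (π := fun _ : ℕ => Fin (m + 1)) n ω)).real {k} = _ :=
      hκk _ _ _
    rw [← Kernel.map_traj_succ_self (X := fun _ => Fin (m + 1)) (κ := κ),
      Kernel.map_apply _ (by fun_prop), measureReal_def,
      Measure.map_apply (by fun_prop) (measurableSet_singleton k)] at h1
    rw [measureReal_def]
    refine h1.trans ?_
    simp only [q, whiteBalls, blackBalls]
    rw [Finset.sum_congr rfl fun i hi => by rw [hext ω i hi],
      Finset.sum_congr (s₁ := Finset.range n) (f := fun i => replBlack m c σ _) rfl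
        fun i hi => by rw [hext ω i hi]]
  have key2 := key.trans (Eventually.of_forall hval)
  have hmeas : @Measurable _ _ (history X n) _
      (fun ω => drawProb mod m (whiteBalls c W₀ X n ω) (blackBalls c σ B₀ X n ω) k) := by
    have hXi : ∀ i ∈ Finset.range n, @Measurable _ _ (history X n) _ (X i) := fun i hi =>
      (comap_measurable (X i)).mono (le_iSup₂_of_le i hi le_rfl) le_rfl
    have hv : @Measurable _ _ (history X n) _
        (fun ω (i : Finset.range n) => X i ω) :=
      @measurable_pi_lambda _ _ _ (history X n) _ _ fun i => hXi i i.2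
    have hg := (measurable_of_countable (fun v : Finset.range n → Fin (m + 1) =>
      drawProb mod m (W₀ + ∑ i ∈ (Finset.range n).attach, replWhite m c (m - (v i : ℕ)))
        (B₀ + ∑ i ∈ (Finset.range n).attach, replBlack m c σ (m - (v i : ℕ))) k)).comp hv
    convert hg using 1
    funext ω
    simp only [whiteBalls, blackBalls, Function.comp_apply]
    rw [Finset.sum_attach (Finset.range n) (fun i => replWhite m c (m - (X i ω : ℕ))),
      Finset.sum_attach (Finset.range n) (fun i => replBlack m c σ (m - (X i ω : ℕ)))]
  have hle' := hle.trans (Filtration.piLE.le n)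
  refine (condExp_condExp_of_le hle (Filtration.piLE.le n)).symm.trans ?_
  refine (condExp_congr_ae key2).trans ?_
  rw [condExp_of_stronglyMeasurable hle' hmeas.stronglyMeasurable]
  exact integrable_condExp.congr key2

end TriangularUrn

end

/-! Write $W_{n+1}=W_n+cK$, where $K$ counts the white balls in the next sample. The $i$-th moment
of $K$ is a polynomial in $W_n$ of degree at most $i$, and without constant term for $i\ge1$
(`drawMoment`, `pCoeff_zero_right`). Conditioning on the past therefore gives a triangular linear
recursion for the moments of $W_n$, with coefficients $f_{n+1,s,r}$ (`moment_succ`). Its solution is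
a sum over descending paths from level $s$ to level $k$: a path that stays at level $u$ at time $j$
picks up $f_{j,u,u}$, and one that jumps from $u$ to $u-a$ picks up $f_{j,u,u-a}$. Splitting
according to the last draw proves this (`phi_succ`, `eq_sum_phi_of_recursion`).

For the diagonal, $f_{n+1,s,s}$ is the value at $n$ of a quotient of two monic polynomials of equal
degree whose subleading coefficients differ by $s\Lambda$. Gauss's product for $\Gamma$ then shows
that $\varphi_{n,s,s}/n^{s\Lambda}$ tends to the nonzero Gamma prefactor
(`exists_tendsto_phi_self`).

After division by $\varphi_{n,s,s}$ the weight of a path no longer depends on $n$, so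
$\varphi_{n,s,k}/\varphi_{n,s,s}$ is a partial sum of a fixed series over jump times. A path is
dominated by a product over its jumps, where a jump from $u$ to $u-a$ at time $n$ contributes
$|f_{n,u,u-a}|\,\varphi_{n,u-a,u-a}/\varphi_{n,u,u}=O(n^{-1-a\Lambda})$. This is summable because
$\Lambda>0$, and the limits follow. -/

noncomputable section

namespace TriangularUrn

/-! ### Moments of a single sample. -/

section DrawMoments

theorem cast_descFactorial_succ (k h : ℕ) :
    (k.descFactorial (h + 1) : ℝ) = k.descFactorial h * ((k : ℝ) - h) := by
  rcases le_or_gt h k with hk | hk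
  · rw [Nat.descFactorial_succ]; push_cast [hk]; ring
  · rw [Nat.descFactorial_of_lt (by omega), Nat.descFactorial_of_lt hk]; simp

theorem pow_eq_sum_stirlingSecond (k i : ℕ) :
    (k : ℝ) ^ i = ∑ h ∈ Finset.range (i + 1), (Nat.stirlingSecond i h : ℝ) * k.descFactorial h := by
  induction i with
  | zero => simp
  | succ i ih =>
    -- An index shift: the factor `h` kills the bottom term, and ${i\brace i+1}=0$ kills the top
    -- one.
    have h1 : ∑ h ∈ Finset.range (i + 1),
        ((h + 1 : ℕ) : ℝ) * Nat.stirlingSecond i (h + 1) * k.descFactorial (h + 1)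
        = ∑ h ∈ Finset.range (i + 1), (h : ℝ) * Nat.stirlingSecond i h * k.descFactorial h := by
      have h2 := Finset.sum_range_succ'
        (fun h : ℕ => (h : ℝ) * Nat.stirlingSecond i h * k.descFactorial h) (i + 1)
      rw [Finset.sum_range_succ, Nat.stirlingSecond_eq_zero_of_lt (Nat.lt_succ_self i)] at h2
      simpa using h2.symm
    rw [pow_succ, ih, Finset.sum_mul, Finset.sum_range_succ' _ (i + 1)]
    simp only [Nat.stirlingSecond_succ_zero, Nat.stirlingSecond_succ_succ]
    push_cast at h1 ⊢
    simp only [add_mul, zero_mul, add_zero, Finset.sum_add_distrib] at h1 ⊢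
    rw [h1, ← Finset.sum_add_distrib]
    refine Finset.sum_congr rfl fun h _ => ?_
    rw [cast_descFactorial_succ]; ring

theorem descFactorial_eq_sum_stirlingFirst (w h : ℕ) :
    (w.descFactorial h : ℝ)
      = ∑ l ∈ Finset.range (h + 1), (-1 : ℝ) ^ (h - l) * Nat.stirlingFirst h l * (w : ℝ) ^ l := by
  -- The sign is written $(-1)^{h+l}$ to keep truncated subtraction out of the induction.
  have key : (w.descFactorial h : ℝ)
      = ∑ l ∈ Finset.range (h + 1), (-1 : ℝ) ^ (h + l) * Nat.stirlingFirst h l * (w : ℝ) ^ l := by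
    induction h with
    | zero => simp
    | succ h ih =>
      have h1 := Finset.sum_range_succ'
        (fun l : ℕ => (-1 : ℝ) ^ (h + l) * (h * Nat.stirlingFirst h l) * (w : ℝ) ^ l) (h + 1)
      rw [Finset.sum_range_succ, Nat.stirlingFirst_eq_zero_of_lt (Nat.lt_succ_self h)] at h1
      have h0 : (h : ℝ) * Nat.stirlingFirst h 0 = 0 := by cases h <;> simp
      rw [h0] at h1
      rw [cast_descFactorial_succ, ih, Finset.sum_range_succ' _ (h + 1)]
      simp only [Nat.stirlingFirst_succ_zero, Nat.stirlingFirst_succ_succ]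
      have h2 : ∀ l : ℕ, (-1 : ℝ) ^ (h + 1 + (l + 1))
          * ((h * Nat.stirlingFirst h (l + 1) + Nat.stirlingFirst h l : ℕ) : ℝ) * (w : ℝ) ^ (l + 1)
          = - ((-1 : ℝ) ^ (h + (l + 1)) * (h * Nat.stirlingFirst h (l + 1)) * (w : ℝ) ^ (l + 1))
            + (-1 : ℝ) ^ (h + l) * Nat.stirlingFirst h l * (w : ℝ) ^ l * w := by
        intro l; push_cast; ring
      rw [Finset.sum_congr rfl fun l _ => h2 l, Finset.sum_add_distrib, Finset.sum_neg_distrib]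
      have h3 : ∑ l ∈ Finset.range (h + 1),
          (-1 : ℝ) ^ (h + (l + 1)) * (h * Nat.stirlingFirst h (l + 1)) * (w : ℝ) ^ (l + 1)
          = ∑ l ∈ Finset.range (h + 1),
            (-1 : ℝ) ^ (h + l) * (h * Nat.stirlingFirst h l) * (w : ℝ) ^ l := by
        simpa using h1.symm
      rw [h3, mul_sub, Finset.sum_mul, Finset.sum_mul]
      simp only [Nat.cast_zero, mul_zero, zero_mul, add_zero]
      rw [neg_add_eq_sub]
      congr 1
      exact Finset.sum_congr rfl fun l _ => by ring
  rw [key]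
  refine Finset.sum_congr rfl fun l hl => ?_
  have hl' : l ≤ h := by simpa [Nat.lt_succ_iff] using hl
  obtain ⟨d, rfl⟩ := Nat.exists_eq_add_of_le hl'
  have h4 : (-1 : ℝ) ^ (l + d + l) = (-1) ^ d := by
    rw [show l + d + l = 2 * l + d by ring, pow_add, pow_mul]; simp
  rw [h4, Nat.add_sub_cancel_left]

/-- By $\binom mk\binom kh=\binom mh\binom{m-h}{k-h}$, what remains is the binomial theorem. -/
theorem sum_choose_mul_binomial {m h : ℕ} (hh : h ≤ m) (w b : ℝ) :
    ∑ k ∈ Finset.range (m + 1), (k.choose h : ℝ) * (m.choose k * w ^ k * b ^ (m - k))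
      = m.choose h * w ^ h * (w + b) ^ (m - h) := by
  obtain ⟨d, rfl⟩ := Nat.exists_eq_add_of_le hh
  rw [add_assoc, Finset.sum_range_add, Finset.sum_eq_zero, zero_add, Nat.add_sub_cancel_left,
    add_pow, Finset.mul_sum]
  · refine Finset.sum_congr rfl fun k _ => ?_
    have h1 : ((h + d).choose (h + k) : ℝ) * (h + k).choose h = (h + d).choose h * d.choose k := by
      have := Nat.choose_mul (n := h + d) (k := h + k) (s := h) (by omega)
      simp only [Nat.add_sub_cancel_left] at this
      exact_mod_cast this
    rw [Nat.add_sub_add_left, pow_add]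
    linear_combination (w ^ h * w ^ k * b ^ (d - k)) * h1
  · intro k hk
    rw [Nat.choose_eq_zero_of_lt (Finset.mem_range.1 hk)]; simp

/-- By $\binom wk\binom kh=\binom wh\binom{w-h}{k-h}$, what remains is Vandermonde's identity. For
$w<h$ both sides vanish. -/
theorem sum_choose_mul_hypergeometric {m h w b : ℕ} (hh : h ≤ m) (hm : m ≤ w + b) :
    ∑ k ∈ Finset.range (m + 1), (k.choose h : ℝ) * (w.choose k * b.choose (m - k))
      = w.choose h * ((w + b - h).choose (m - h) : ℝ) := by
  obtain ⟨d, rfl⟩ := Nat.exists_eq_add_of_le hh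
  rw [add_assoc, Finset.sum_range_add, Finset.sum_eq_zero, zero_add, Nat.add_sub_cancel_left]
  · rcases le_or_gt h w with hw | hw
    · have h0 := Nat.add_choose_eq (w - h) b d
      rw [Finset.Nat.sum_antidiagonal_eq_sum_range_succ
        (fun i j => (w - h).choose i * b.choose j) d] at h0
      rw [show w + b - h = w - h + b by omega, h0]
      push_cast
      rw [Finset.mul_sum]
      refine Finset.sum_congr rfl fun k _ => ?_
      have h1 : (w.choose (h + k) : ℝ) * (h + k).choose h = w.choose h * (w - h).choose k := by
        have := Nat.choose_mul (n := w) (k := h + k) (s := h) (by omega)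
        simp only [Nat.add_sub_cancel_left] at this
        exact_mod_cast this
      rw [Nat.add_sub_add_left]
      linear_combination (b.choose (d - k) : ℝ) * h1
    · rw [Nat.choose_eq_zero_of_lt hw, Nat.cast_zero, zero_mul]
      refine Finset.sum_eq_zero fun k _ => ?_
      rw [Nat.choose_eq_zero_of_lt (show w < h + k by omega)]; simp
  · intro k hk
    rw [Nat.choose_eq_zero_of_lt (Finset.mem_range.1 hk)]; simp

theorem factorialMoment_M {m w b : ℕ} (hm : m ≤ w + b) (h : ℕ) :
    ∑ k ∈ Finset.range (m + 1), drawProb .M m w b k * k.descFactorial h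
      = m.choose h / (w + b).choose h * w.descFactorial h := by
  rcases le_or_gt h m with hh | hh
  · have h0 := sum_choose_mul_hypergeometric hh hm
    have h1 : (((w + b).choose m : ℝ)) * m.choose h
        = (w + b).choose h * (w + b - h).choose (m - h) := by
      exact_mod_cast Nat.choose_mul hh
    have h2 : ((w + b).choose m : ℝ) ≠ 0 := by exact_mod_cast (Nat.choose_pos hm).ne'
    have h3 : ((w + b).choose h : ℝ) ≠ 0 := by exact_mod_cast (Nat.choose_pos (hh.trans hm)).ne'
    simp only [drawProb, Nat.descFactorial_eq_factorial_mul_choose, Nat.cast_mul]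
    have h4 : ∀ k : ℕ, (w.choose k : ℝ) * b.choose (m - k) / (w + b).choose m
        * (h.factorial * k.choose h)
        = h.factorial / (w + b).choose m * (k.choose h * (w.choose k * b.choose (m - k))) := by
      intro k; ring
    rw [Finset.sum_congr rfl fun k _ => h4 k, ← Finset.mul_sum, h0]
    field_simp
    linear_combination (-(w.choose h : ℝ)) * h1
  · rw [Nat.choose_eq_zero_of_lt hh, Finset.sum_eq_zero]
    · simp
    · intro k hk
      rw [Nat.descFactorial_of_lt (by have := Finset.mem_range.1 hk; omega)]; simp

theorem factorialMoment_R {m w b : ℕ} (hT : 0 < w + b) (h : ℕ) :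
    ∑ k ∈ Finset.range (m + 1), drawProb .R m w b k * k.descFactorial h
      = m.descFactorial h / ((w + b : ℕ) : ℝ) ^ h * (w : ℝ) ^ h := by
  rcases le_or_gt h m with hh | hh
  · have h0 := sum_choose_mul_binomial hh (w : ℝ) b
    have h2 : (w : ℝ) + b ≠ 0 := by exact_mod_cast hT.ne'
    simp only [drawProb, Nat.descFactorial_eq_factorial_mul_choose, Nat.cast_mul]
    have h4 : ∀ k : ℕ, (m.choose k : ℝ) * (w : ℝ) ^ k * (b : ℝ) ^ (m - k) / ((w : ℝ) + b) ^ m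
        * (h.factorial * k.choose h)
        = h.factorial / ((w : ℝ) + b) ^ m
          * (k.choose h * (m.choose k * (w : ℝ) ^ k * (b : ℝ) ^ (m - k))) := by
      intro k; ring
    rw [Finset.sum_congr rfl fun k _ => h4 k, ← Finset.mul_sum, h0]
    obtain ⟨d, rfl⟩ := Nat.exists_eq_add_of_le hh
    rw [Nat.add_sub_cancel_left]
    push_cast
    field_simp
    ring
  · rw [Nat.descFactorial_of_lt hh, Finset.sum_eq_zero]
    · simp
    · intro k hk
      rw [Nat.descFactorial_of_lt (by have := Finset.mem_range.1 hk; omega)]; simp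

/-- The moments of the number of white balls in a sample. -/
theorem drawMoment (mod : Model) {m w b : ℕ} (hm : 1 ≤ m) (hT : m ≤ w + b) (i : ℕ) :
    ∑ k ∈ Finset.range (m + 1), drawProb mod m w b k * (k : ℝ) ^ i
      = ∑ l ∈ Finset.range (i + 1), pCoeff mod m (w + b) i l * (w : ℝ) ^ l := by
  have h0 : ∑ k ∈ Finset.range (m + 1), drawProb mod m w b k * (k : ℝ) ^ i
      = ∑ h ∈ Finset.range (i + 1), (Nat.stirlingSecond i h : ℝ)
        * ∑ k ∈ Finset.range (m + 1), drawProb mod m w b k * k.descFactorial h := by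
    simp only [pow_eq_sum_stirlingSecond _ i, Finset.mul_sum]
    rw [Finset.sum_comm]
    exact Finset.sum_congr rfl fun h _ => Finset.sum_congr rfl fun k _ => by ring
  rw [h0]
  cases mod with
  | R =>
    refine Finset.sum_congr rfl fun h _ => ?_
    rw [factorialMoment_R (by omega)]
    simp only [pCoeff]; ring
  | M =>
    simp only [factorialMoment_M hT, pCoeff]
    -- Without replacement the factorial moments involve falling factorials of `w`, so a second
    -- Stirling conversion is needed.
    have h1 : ∀ h : ℕ, (w.descFactorial h : ℝ) = ∑ l ∈ Finset.range (h + 1),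
        (-1 : ℝ) ^ (h - l) * Nat.stirlingFirst h l * (w : ℝ) ^ l :=
      descFactorial_eq_sum_stirlingFirst w
    simp only [h1, Finset.mul_sum, Finset.sum_mul]
    rw [Finset.sum_sigma', Finset.sum_sigma']
    symm
    -- Only one side is cut off at `h ≤ m`; the extra terms on the other contain $\binom mh=0$.
    refine Finset.sum_bij_ne_zero (fun x _ _ => ⟨x.2, x.1⟩) ?_ ?_ ?_ ?_
    · rintro ⟨l, h⟩ hx _
      simp only [Finset.mem_sigma, Finset.mem_range, Finset.mem_Icc] at hx ⊢
      omega
    · rintro ⟨l, h⟩ _ _ ⟨l', h'⟩ _ _ e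
      simp only [Sigma.mk.injEq, heq_eq_eq] at e ⊢
      exact e.symm
    · rintro ⟨h, l⟩ hx hne
      have hhm : h ≤ m := by
        by_contra hc
        exact hne (by simp [Nat.choose_eq_zero_of_lt (not_le.1 hc)])
      refine ⟨⟨l, h⟩, ?_, ?_, rfl⟩
      · simp only [Finset.mem_sigma, Finset.mem_range, Finset.mem_Icc] at hx ⊢
        omega
      · intro hz; apply hne; rw [← hz]; ring
    · rintro ⟨l, h⟩ _ _
      ring

/-- An urn without white balls yields none, so there is no constant term. -/
theorem pCoeff_zero_right (mod : Model) (m T : ℕ) {i : ℕ} (hi : 1 ≤ i) :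
    pCoeff mod m T i 0 = 0 := by
  obtain ⟨i, rfl⟩ := Nat.exists_eq_add_of_le' hi
  cases mod with
  | R => simp [pCoeff]
  | M =>
    refine Finset.sum_eq_zero fun h _ => ?_
    cases h <;> simp

theorem index_mul_pow {m σ : ℕ} (c : ℕ) (hm : m ≠ 0) (hσ : σ ≠ 0) (j : ℕ) :
    index m c σ ^ j * (σ : ℝ) ^ j / (m : ℝ) ^ j = (c : ℝ) ^ j := by
  have hm' : (m : ℝ) ≠ 0 := by exact_mod_cast hm
  have hσ' : (σ : ℝ) ≠ 0 := by exact_mod_cast hσ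
  rw [← mul_pow, ← div_pow]
  congr 1
  rw [index]
  field_simp

theorem fCoeff_succ (mod : Model) {m σ : ℕ} (c T₀ : ℕ) (hm : m ≠ 0) (hσ : σ ≠ 0) (n s r : ℕ) :
    fCoeff mod m c σ T₀ (n + 1) s r = ∑ j ∈ Finset.Icc (s - r) s,
      (s.choose j : ℝ) * (c : ℝ) ^ j * pCoeff mod m (T₀ + σ * n) j (j - (s - r)) := by
  rw [fCoeff, if_neg (Nat.succ_ne_zero n)]
  simp only [index_mul_pow c hm hσ, Nat.add_sub_cancel]

theorem fCoeff_zero_left (mod : Model) (m c σ T₀ s r : ℕ) : fCoeff mod m c σ T₀ 0 s r = 1 :=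
  if_pos rfl

/-- The conditional `s`-th moment of the number of white balls after one more draw. -/
theorem stepMoment (mod : Model) {m c σ T₀ w b n : ℕ} (hm : 1 ≤ m) (hσ : σ ≠ 0) (hT : m ≤ w + b)
    (hn : w + b = T₀ + σ * n) {s : ℕ} (hs : 1 ≤ s) :
    ∑ k ∈ Finset.range (m + 1), drawProb mod m w b k * ((w : ℝ) + k * c) ^ s
      = ∑ r ∈ Finset.Icc 1 s, fCoeff mod m c σ T₀ (n + 1) s r * (w : ℝ) ^ r := by
  have h0 : ∑ k ∈ Finset.range (m + 1), drawProb mod m w b k * ((w : ℝ) + k * c) ^ s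
      = ∑ j ∈ Finset.range (s + 1), (s.choose j : ℝ) * (c : ℝ) ^ j * (w : ℝ) ^ (s - j)
        * ∑ k ∈ Finset.range (m + 1), drawProb mod m w b k * (k : ℝ) ^ j := by
    simp only [add_comm (w : ℝ), add_pow, Finset.mul_sum]
    rw [Finset.sum_comm]
    exact Finset.sum_congr rfl fun h _ => Finset.sum_congr rfl fun k _ => by ring
  -- The term `r = 0` may be added: its only summand contains $p_{n+1;(s,0)}=0$.
  have h1 : ∑ r ∈ Finset.Icc 1 s, fCoeff mod m c σ T₀ (n + 1) s r * (w : ℝ) ^ r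
      = ∑ r ∈ Finset.range (s + 1), fCoeff mod m c σ T₀ (n + 1) s r * (w : ℝ) ^ r := by
    rw [Finset.sum_range_succ', Finset.range_eq_Ico, Finset.sum_Ico_add'
      (fun r => fCoeff mod m c σ T₀ (n + 1) s r * (w : ℝ) ^ r) 0 s 1]
    rw [fCoeff_succ mod c T₀ (by omega) hσ]
    simp only [Nat.sub_zero, Finset.Icc_self, Finset.sum_singleton, Nat.sub_self,
      pCoeff_zero_right mod _ _ hs, mul_zero, zero_mul, add_zero]
    rfl
  rw [h0, h1]
  simp only [drawMoment mod hm hT, fCoeff_succ mod c T₀ (show m ≠ 0 by omega) hσ, hn,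
    Finset.mul_sum, Finset.sum_mul]
  rw [Finset.sum_sigma', Finset.sum_sigma']
  -- The pair $(j,l)$ contributes to $w^{s-j+l}$, hence $r=s-j+l$.
  refine Finset.sum_bij' (fun x _ => ⟨s - x.1 + x.2, x.1⟩) (fun x _ => ⟨x.2, x.2 - (s - x.1)⟩)
    ?_ ?_ ?_ ?_ ?_
  · rintro ⟨j, l⟩ hx
    simp only [Finset.mem_sigma, Finset.mem_range, Finset.mem_Icc] at hx ⊢
    omega
  · rintro ⟨r, j⟩ hx
    simp only [Finset.mem_sigma, Finset.mem_range, Finset.mem_Icc] at hx ⊢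
    omega
  · rintro ⟨j, l⟩ hx
    simp only [Finset.mem_sigma, Finset.mem_range, Sigma.mk.injEq, heq_eq_eq, true_and] at hx ⊢
    omega
  · rintro ⟨r, j⟩ hx
    simp only [Finset.mem_sigma, Finset.mem_range, Finset.mem_Icc, Sigma.mk.injEq, heq_eq_eq,
      and_true] at hx ⊢
    omega
  · rintro ⟨j, l⟩ hx
    simp only [Finset.mem_sigma, Finset.mem_range] at hx ⊢
    rw [show j - (s - (s - j + l)) = l by omega, pow_add]
    ring

end DrawMoments

/-! ### The moment recursion of the urn process. -/

section UrnMoments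

variable {Ω : Type*} {m c σ W₀ B₀ : ℕ} {X : ℕ → Ω → Fin (m + 1)}

theorem replWhite_sub (c : ℕ) (x : Fin (m + 1)) : replWhite m c (m - (x : ℕ)) = x * c := by
  rw [replWhite]
  congr 1
  omega

theorem whiteBalls_succ (n : ℕ) (ω : Ω) :
    whiteBalls c W₀ X (n + 1) ω = whiteBalls c W₀ X n ω + X n ω * c := by
  rw [whiteBalls, Finset.sum_range_succ, replWhite_sub, whiteBalls, add_assoc]

theorem whiteBalls_add_blackBalls (hσ : m * c ≤ σ) (n : ℕ) (ω : Ω) :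
    whiteBalls c W₀ X n ω + blackBalls c σ B₀ X n ω = W₀ + B₀ + σ * n := by
  have h : ∀ i ∈ Finset.range n, replWhite m c (m - (X i ω : ℕ)) +
      replBlack m c σ (m - (X i ω : ℕ)) = σ := by
    intro i _
    have : (m - (m - (X i ω : ℕ))) * c ≤ m * c := Nat.mul_le_mul_right _ (Nat.sub_le _ _)
    rw [replWhite, replBlack]
    omega
  have h2 := Finset.sum_congr rfl h
  rw [Finset.sum_add_distrib, Finset.sum_const, Finset.card_range, smul_eq_mul] at h2
  rw [whiteBalls, blackBalls, mul_comm σ n, ← h2]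
  ring

theorem whiteBalls_le (n : ℕ) (ω : Ω) : whiteBalls c W₀ X n ω ≤ W₀ + n * (m * c) := by
  rw [whiteBalls]
  gcongr
  calc _ ≤ ∑ i ∈ Finset.range n, m * c := by
        refine Finset.sum_le_sum fun i _ => ?_
        rw [replWhite_sub]
        exact Nat.mul_le_mul_right _ (Nat.lt_succ_iff.1 (X i ω).2)
    _ = n * (m * c) := by simp

theorem measurable_history_of_lt {i n : ℕ} (h : i < n) : Measurable[history X n] (X i) :=
  (comap_measurable (X i)).mono (le_iSup₂_of_le i (Finset.mem_range.2 h) le_rfl) le_rfl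

theorem measurable_sum_history (n : ℕ) (a : ℕ) (g : Fin (m + 1) → ℕ) :
    Measurable[history X n] (fun ω => a + ∑ i ∈ Finset.range n, g (X i ω)) := by
  have h : ∀ i ∈ Finset.range n, Measurable[history X n] (fun ω => g (X i ω)) := fun i hi =>
    (measurable_of_countable g).comp (measurable_history_of_lt (Finset.mem_range.1 hi))
  exact (measurable_of_countable (fun x : ℕ => a + x)).comp (Finset.measurable_fun_sum _ h)

theorem measurable_whiteBalls (n : ℕ) : Measurable[history X n] (whiteBalls c W₀ X n) :=
  measurable_sum_history n W₀ fun x => replWhite m c (m - (x : ℕ))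

variable [MeasurableSpace Ω] {mod : Model} {P : Measure Ω}

theorem IsUrnProcess.history_le (hX : IsUrnProcess mod c σ W₀ B₀ P X) (n : ℕ) :
    history X n ≤ ‹MeasurableSpace Ω› :=
  iSup₂_le fun i _ => (hX.measurable_draw i).comap_le

variable [IsProbabilityMeasure P]

/-- $W_n$ takes finitely many values, so an arbitrary `g` is bounded on them. -/
theorem IsUrnProcess.integrable_comp (hX : IsUrnProcess mod c σ W₀ B₀ P X) (n : ℕ) (g : ℕ → ℝ) :
    Integrable (fun ω => g (whiteBalls c W₀ X n ω)) P := by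
  have hm : Measurable (fun ω => g (whiteBalls c W₀ X n ω)) :=
    (measurable_of_countable g).comp ((measurable_whiteBalls n).mono (hX.history_le n) le_rfl)
  refine Integrable.of_bound hm.aestronglyMeasurable
    (∑ x ∈ Finset.range (W₀ + n * (m * c) + 1), ‖g x‖) (Eventually.of_forall fun ω => ?_)
  exact Finset.single_le_sum (f := fun x => ‖g x‖) (fun _ _ => norm_nonneg _)
    (Finset.mem_range.2 (Nat.lt_succ_of_le (whiteBalls_le n ω)))

/-- Conditioning on the past evaluates the expectation of functions of the current urn and the
next sample. -/
theorem IsUrnProcess.integral_indicator_mul (hX : IsUrnProcess mod c σ W₀ B₀ P X) (n : ℕ)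
    (k : Fin (m + 1)) (g : ℕ → ℝ) :
    Integrable (fun ω => g (whiteBalls c W₀ X n ω) *
      (X n ⁻¹' {k}).indicator (fun _ => (1 : ℝ)) ω) P ∧
    ∫ ω, g (whiteBalls c W₀ X n ω) * (X n ⁻¹' {k}).indicator (fun _ => (1 : ℝ)) ω ∂P
      = ∫ ω, g (whiteBalls c W₀ X n ω) *
          drawProb mod m (whiteBalls c W₀ X n ω) (blackBalls c σ B₀ X n ω) k ∂P := by
  have hS := hX.measurable_draw n (measurableSet_singleton k)
  have hi : Integrable ((X n ⁻¹' {k}).indicator (fun _ => (1 : ℝ))) P :=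
    (integrable_const _).indicator hS
  have hgi : Integrable (fun ω => g (whiteBalls c W₀ X n ω) *
      (X n ⁻¹' {k}).indicator (fun _ => (1 : ℝ)) ω) P := by
    have := (hX.integrable_comp n g).indicator hS
    refine this.congr (Eventually.of_forall fun ω => ?_)
    by_cases h : ω ∈ X n ⁻¹' {k} <;> simp only [Set.indicator, h] <;> simp
  refine ⟨hgi, ?_⟩
  have hsm : StronglyMeasurable[history X n] (fun ω => g (whiteBalls c W₀ X n ω)) :=
    ((measurable_of_countable g).comp (measurable_whiteBalls n)).stronglyMeasurable
  -- The factor known from the history is pulled out of the conditional expectation; `draw_law`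
  -- evaluates the rest.
  have h1 := condExp_mul_of_stronglyMeasurable_left hsm hgi hi
  have h2 := integral_condExp (μ := P) (hX.history_le n)
    (f := (fun ω => g (whiteBalls c W₀ X n ω)) * (X n ⁻¹' {k}).indicator (fun _ => (1 : ℝ)))
  refine (h2.symm.trans (integral_congr_ae (h1.trans ?_)))
  filter_upwards [hX.draw_law n k] with ω hω
  simp only [Pi.mul_apply, hω]

/-- The recursion for the moments of `W_n`. -/
theorem IsUrnProcess.moment_succ (hX : IsUrnProcess mod c σ W₀ B₀ P X) (hm : 1 ≤ m)
    (hσ0 : σ ≠ 0) (hσ : m * c ≤ σ) (hT₀ : m ≤ W₀ + B₀) (n : ℕ) {s : ℕ} (hs : 1 ≤ s) :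
    ∫ ω, (whiteBalls c W₀ X (n + 1) ω : ℝ) ^ s ∂P
      = ∑ r ∈ Finset.Icc 1 s, fCoeff mod m c σ (W₀ + B₀) (n + 1) s r
          * ∫ ω, (whiteBalls c W₀ X n ω : ℝ) ^ r ∂P := by
  -- Split according to the outcome of the next draw.
  have h0 : ∀ ω, (whiteBalls c W₀ X (n + 1) ω : ℝ) ^ s = ∑ k : Fin (m + 1),
      ((whiteBalls c W₀ X n ω : ℝ) + (k : ℕ) * c) ^ s
        * (X n ⁻¹' {k}).indicator (fun _ => (1 : ℝ)) ω := by
    intro ω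
    rw [Finset.sum_eq_single (X n ω)]
    · rw [whiteBalls_succ]; simp
    · intro k _ hk
      rw [Set.indicator_of_notMem (by simpa using hk.symm), mul_zero]
    · simp
  have hint := fun k : Fin (m + 1) => hX.integral_indicator_mul n k
    (fun w => ((w : ℝ) + (k : ℕ) * c) ^ s)
  have hdp : ∀ k : Fin (m + 1), Integrable (fun ω => ((whiteBalls c W₀ X n ω : ℝ) + (k : ℕ) * c) ^ s
      * drawProb mod m (whiteBalls c W₀ X n ω) (blackBalls c σ B₀ X n ω) k) P := by
    intro k
    -- As $W_n+B_n=T_n$ is deterministic, the integrand is a function of $W_n$ alone.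
    refine (hX.integrable_comp n (fun w => ((w : ℝ) + (k : ℕ) * c) ^ s
      * drawProb mod m w (W₀ + B₀ + σ * n - w) k)).congr (Eventually.of_forall fun ω => ?_)
    have := whiteBalls_add_blackBalls (W₀ := W₀) (B₀ := B₀) (X := X) hσ n ω
    simp only
    rw [← this, Nat.add_sub_cancel_left]
  rw [integral_congr_ae (Eventually.of_forall h0), integral_finsetSum _ fun k _ => (hint k).1,
    Finset.sum_congr rfl fun k _ => (hint k).2, ← integral_finsetSum _ fun k _ => hdp k]
  simp only [← integral_const_mul]
  rw [← integral_finsetSum _ fun r _ =>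
    (hX.integrable_comp n (fun w => (w : ℝ) ^ r)).const_mul _]
  refine integral_congr_ae (Eventually.of_forall fun ω => ?_)
  have hT := whiteBalls_add_blackBalls (W₀ := W₀) (B₀ := B₀) (X := X) hσ n ω
  simp only
  rw [← stepMoment mod hm hσ0 (by omega) hT hs, ← Fin.sum_univ_eq_sum_range
    (fun k => drawProb mod m _ _ k * ((whiteBalls c W₀ X n ω : ℝ) + k * c) ^ s)]
  exact Finset.sum_congr rfl fun k _ => mul_comm _ _

end UrnMoments

/-! ### Path sums solve the triangular recursion. -/

section PathSums

theorem mem_jumpTimes {l n : ℕ} {i : Fin l → ℕ} :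
    i ∈ jumpTimes l n ↔ (∀ a, 1 ≤ i a ∧ i a ≤ n) ∧ ∀ a b, a < b → i b < i a := by
  simp [jumpTimes, Fintype.mem_piFinset]

theorem mem_jumpHeights {l N : ℕ} {h : Fin l → ℕ} :
    h ∈ jumpHeights l N ↔ ∑ ν, h ν = N ∧ ∀ ν, 1 ≤ h ν := by
  simp [jumpHeights]

/-- Jump times decrease, so the head `t` is the latest one and all others lie below it. All later
inductions peel off this jump. -/
theorem cons_mem_jumpTimes {l n t : ℕ} {i : Fin l → ℕ} :
    (Fin.cons t i : Fin (l + 1) → ℕ) ∈ jumpTimes (l + 1) n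
      ↔ 1 ≤ t ∧ t ≤ n ∧ i ∈ jumpTimes l (t - 1) := by
  simp only [mem_jumpTimes, Fin.forall_fin_succ, Fin.cons_zero, Fin.cons_succ,
    Fin.succ_lt_succ_iff, Fin.succ_pos, Fin.not_lt_zero, forall_true_left, false_imp_iff,
    true_and]
  constructor
  · rintro ⟨⟨⟨h1, h2⟩, h3⟩, h4, h5⟩
    exact ⟨h1, h2, fun a => ⟨(h3 a).1, by have := h4 a; omega⟩, h5⟩
  · rintro ⟨h1, h2, h3, h4⟩
    exact ⟨⟨⟨h1, h2⟩, fun a => ⟨(h3 a).1, by have := h3 a; omega⟩⟩,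
      fun a => by have := h3 a; omega, h4⟩

theorem jumpTimes_subset {l n n' : ℕ} (h : n ≤ n') : jumpTimes l n ⊆ jumpTimes l n' := by
  intro i hi
  rw [mem_jumpTimes] at hi ⊢
  exact ⟨fun a => ⟨(hi.1 a).1, (hi.1 a).2.trans h⟩, hi.2⟩

theorem cons_mem_jumpHeights {l N a : ℕ} {h : Fin l → ℕ} :
    (Fin.cons a h : Fin (l + 1) → ℕ) ∈ jumpHeights (l + 1) N
      ↔ a ∈ Finset.Icc 1 N ∧ h ∈ jumpHeights l (N - a) := by
  simp only [mem_jumpHeights, Fin.sum_univ_succ, Fin.forall_fin_succ, Fin.cons_zero, Fin.cons_succ,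
    Finset.mem_Icc]
  constructor
  · rintro ⟨h1, h2, h3⟩
    exact ⟨⟨h2, by omega⟩, by omega, h3⟩
  · rintro ⟨⟨h1, h2⟩, h3, h4⟩
    exact ⟨by omega, h1, h4⟩

theorem jumpHeights_eq_empty {l N : ℕ} (h : N < l) : jumpHeights l N = ∅ := by
  refine Finset.eq_empty_of_forall_notMem fun x hx => ?_
  rw [mem_jumpHeights] at hx
  have := Finset.sum_le_sum (s := Finset.univ) fun ν _ => hx.2 ν
  simp only [Finset.sum_const, Finset.card_univ, Fintype.card_fin, smul_eq_mul, mul_one] at this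
  omega

theorem sum_jumpHeights_succ {l N : ℕ} (F : (Fin (l + 1) → ℕ) → ℝ) :
    ∑ h ∈ jumpHeights (l + 1) N, F h
      = ∑ a ∈ Finset.Icc 1 N, ∑ h ∈ jumpHeights l (N - a), F (Fin.cons a h) := by
  rw [Finset.sum_sigma']
  refine Finset.sum_bij' (fun h _ => ⟨h 0, Fin.tail h⟩) (fun x _ => Fin.cons x.1 x.2) ?_ ?_ ?_ ?_ ?_
  · intro h hh
    rw [← Fin.cons_self_tail h, cons_mem_jumpHeights] at hh
    exact Finset.mem_sigma.2 hh
  · rintro ⟨a, h⟩ hx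
    exact cons_mem_jumpHeights.2 (Finset.mem_sigma.1 hx)
  · intro h _; exact Fin.cons_self_tail h
  · rintro ⟨a, h⟩ _; simp
  · intro h _; rw [Fin.cons_self_tail]

/-- The latest jump either happens by time `n` or at time `n + 1`. -/
theorem sum_jumpTimes_succ {l n : ℕ} (F : (Fin (l + 1) → ℕ) → ℝ) :
    ∑ i ∈ jumpTimes (l + 1) (n + 1), F i
      = ∑ i ∈ jumpTimes (l + 1) n, F i + ∑ i ∈ jumpTimes l n, F (Fin.cons (n + 1) i) := by
  rw [← Finset.sum_sdiff (jumpTimes_subset (l := l + 1) (Nat.le_succ n)), add_comm]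
  congr 1
  refine Finset.sum_bij' (fun i _ => Fin.tail i) (fun i _ => Fin.cons (n + 1) i) ?_ ?_ ?_ ?_ ?_
  · intro i hi
    rw [Finset.mem_sdiff, ← Fin.cons_self_tail i, cons_mem_jumpTimes, cons_mem_jumpTimes] at hi
    have h0 : i 0 = n + 1 := by
      by_contra h
      exact hi.2 ⟨hi.1.1, by have := hi.1.2.1; omega, hi.1.2.2⟩
    simpa [h0] using hi.1.2.2
  · intro i hi
    rw [Finset.mem_sdiff, cons_mem_jumpTimes, cons_mem_jumpTimes]
    exact ⟨⟨by omega, le_rfl, by simpa using hi⟩, by omega⟩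
  · intro i hi
    rw [Finset.mem_sdiff, ← Fin.cons_self_tail i, cons_mem_jumpTimes, cons_mem_jumpTimes] at hi
    have h0 : i 0 = n + 1 := by
      by_contra h
      exact hi.2 ⟨hi.1.1, by have := hi.1.2.1; omega, hi.1.2.2⟩
    rw [← h0, Fin.cons_self_tail]
  · intro i _; simp
  · intro i hi
    rw [Finset.mem_sdiff, ← Fin.cons_self_tail i, cons_mem_jumpTimes, cons_mem_jumpTimes] at hi
    have h0 : i 0 = n + 1 := by
      by_contra h
      exact hi.2 ⟨hi.1.1, by have := hi.1.2.1; omega, hi.1.2.2⟩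
    rw [← h0, Fin.cons_self_tail]

theorem extTimes_zero {l : ℕ} (top : ℕ) (i : Fin l → ℕ) : extTimes top i 0 = top := rfl

theorem extTimes_cons_succ {l : ℕ} (top t : ℕ) (i : Fin l → ℕ) (g : ℕ) :
    extTimes top (Fin.cons t i : Fin (l + 1) → ℕ) (g + 1) = extTimes t i g := by
  cases g with
  | zero => simp [extTimes]
  | succ g =>
    simp only [extTimes, Nat.add_sub_cancel, Nat.succ_ne_zero, if_false]
    by_cases h : g < l
    · rw [dif_pos h, dif_pos (by omega)]
      exact Fin.cons_succ (α := fun _ => ℕ) t i ⟨g, h⟩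
    · rw [dif_neg h, dif_neg (by omega)]

theorem partialHeight_zero {l : ℕ} (h : Fin l → ℕ) : partialHeight h 0 = 0 := by
  simp [partialHeight]

theorem partialHeight_cons_succ {l : ℕ} (a : ℕ) (h : Fin l → ℕ) (g : ℕ) :
    partialHeight (Fin.cons a h : Fin (l + 1) → ℕ) (g + 1) = a + partialHeight h g := by
  simp [partialHeight, Fin.sum_univ_succ]

variable (f : ℕ → ℕ → ℕ → ℝ)

/-- The product of all factors that belong to one choice of jump heights and jump times. -/
def pathProd (s : ℕ) {l : ℕ} (h : Fin l → ℕ) (top : ℕ) (i : Fin l → ℕ) : ℝ :=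
  ∏ g ∈ Finset.Icc 1 (l + 1), stepFactor f s h top i g

/-- The last factor of a path is read at $i_{\ell+1}=0$; the convention $f_{0,s,s}=1$ makes it
harmless. -/
theorem pathProd_zero (hf : ∀ s, f 0 s s = 1) (s : ℕ) (h : Fin 0 → ℕ) (top : ℕ) (i : Fin 0 → ℕ) :
    pathProd f s h top i = ∏ j ∈ Finset.Icc 1 (top - 1), f j s s := by
  simp [pathProd, stepFactor, extTimes, partialHeight, hf]

theorem stepFactor_cons_add_two (s : ℕ) {l : ℕ} (a : ℕ) (h : Fin l → ℕ) (top t : ℕ)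
    (i : Fin l → ℕ) (g : ℕ) :
    stepFactor f s (Fin.cons a h : Fin (l + 1) → ℕ) top (Fin.cons t i : Fin (l + 1) → ℕ) (g + 2)
      = stepFactor f (s - a) h t i (g + 1) := by
  simp only [stepFactor, show g + 2 = g + 1 + 1 from rfl, extTimes_cons_succ,
    partialHeight_cons_succ, Nat.add_sub_cancel, Nat.sub_sub]

theorem prod_stepFactor_cons (s : ℕ) {l : ℕ} (a : ℕ) (h : Fin l → ℕ) (top t : ℕ)
    (i : Fin l → ℕ) :
    ∏ g ∈ Finset.Icc 2 (l + 1 + 1), stepFactor f s (Fin.cons a h : Fin (l + 1) → ℕ) top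
        (Fin.cons t i : Fin (l + 1) → ℕ) g
      = pathProd f (s - a) h t i := by
  have h1 : Finset.Icc 2 (l + 1 + 1) = (Finset.Icc 1 (l + 1)).map (addRightEmbedding 1) := by
    rw [Finset.map_add_right_Icc]
  rw [h1, Finset.prod_map, pathProd]
  refine Finset.prod_congr rfl fun g hg => ?_
  obtain ⟨g, rfl⟩ := Nat.exists_eq_add_of_le' (Finset.mem_Icc.1 hg).1
  exact stepFactor_cons_add_two f s a h top t i g

/-- Behind the latest jump there remains a path of the same kind, with starting level `s - a` and
top `t`. -/
theorem pathProd_cons (s : ℕ) {l : ℕ} (a : ℕ) (h : Fin l → ℕ) (top t : ℕ) (i : Fin l → ℕ) :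
    pathProd f s (Fin.cons a h : Fin (l + 1) → ℕ) top (Fin.cons t i : Fin (l + 1) → ℕ)
      = f t s (s - a) * (∏ j ∈ Finset.Icc (t + 1) (top - 1), f j s s)
        * pathProd f (s - a) h t i := by
  rw [pathProd, ← Finset.mul_prod_Ioc_eq_prod_Icc (by omega), ← prod_stepFactor_cons f s a h top]
  congr 1
  simp only [stepFactor, Nat.sub_self, extTimes_zero, partialHeight_zero, Nat.sub_zero]
  have e1 := extTimes_cons_succ top t i 0
  have e2 := partialHeight_cons_succ a h 0
  simp only [zero_add, extTimes_zero, partialHeight_zero, add_zero] at e1 e2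
  rw [e1, e2]

/-- The sum over all jump times for fixed jump heights. -/
def pathSum (n s : ℕ) {l : ℕ} (h : Fin l → ℕ) : ℝ :=
  ∑ i ∈ jumpTimes l n, pathProd f s h (n + 1) i

theorem pathSum_zero (hf : ∀ s, f 0 s s = 1) (n s : ℕ) (h : Fin 0 → ℕ) :
    pathSum f n s h = ∏ j ∈ Finset.Icc 1 n, f j s s := by
  have : jumpTimes 0 n = {Fin.elim0} := by
    ext i
    simp [mem_jumpTimes, Subsingleton.elim i Fin.elim0]
  rw [pathSum, this, Finset.sum_singleton, pathProd_zero f hf, Nat.add_sub_cancel]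

theorem pathSum_succ_zero (hf : ∀ s, f 0 s s = 1) (n s : ℕ) (h : Fin 0 → ℕ) :
    pathSum f (n + 1) s h = f (n + 1) s s * pathSum f n s h := by
  rw [pathSum_zero f hf, pathSum_zero f hf, Finset.prod_Icc_succ_top (by omega), mul_comm]

theorem pathProd_succ_top (s : ℕ) {l : ℕ} (h : Fin (l + 1) → ℕ) {n : ℕ} {i : Fin (l + 1) → ℕ}
    (hi : i ∈ jumpTimes (l + 1) n) :
    pathProd f s h (n + 2) i = f (n + 1) s s * pathProd f s h (n + 1) i := by
  obtain ⟨a, h, rfl⟩ : ∃ a h', h = Fin.cons a h' := ⟨h 0, Fin.tail h, (Fin.cons_self_tail h).symm⟩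
  obtain ⟨t, i, rfl⟩ : ∃ a h', i = Fin.cons a h' := ⟨i 0, Fin.tail i, (Fin.cons_self_tail i).symm⟩
  rw [cons_mem_jumpTimes] at hi
  rw [pathProd_cons, pathProd_cons, show n + 2 - 1 = n + 1 by omega,
    Finset.prod_Icc_succ_top (by omega), Nat.add_sub_cancel]
  ring

theorem pathSum_succ_cons (n s : ℕ) {l : ℕ} (a : ℕ) (h : Fin l → ℕ) :
    pathSum f (n + 1) s (Fin.cons a h : Fin (l + 1) → ℕ)
      = f (n + 1) s s * pathSum f n s (Fin.cons a h : Fin (l + 1) → ℕ)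
        + f (n + 1) s (s - a) * pathSum f n (s - a) h := by
  rw [pathSum, sum_jumpTimes_succ, pathSum, Finset.mul_sum, pathSum, Finset.mul_sum]
  congr 1
  · exact Finset.sum_congr rfl fun i hi => pathProd_succ_top f s _ hi
  · refine Finset.sum_congr rfl fun i _ => ?_
    rw [pathProd_cons, Finset.Icc_eq_empty (by omega), Finset.prod_empty, mul_one]

/-- Allowing zero jumps unites the cases $k=s$ and $k<s$. The slack in `L` costs nothing, as more
than $s-k$ jumps are impossible, and it gives different levels a common range. -/
theorem phi_eq_sum_pathSum (hf : ∀ s, f 0 s s = 1) (n : ℕ) {s k L : ℕ} (hk : k ≤ s)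
    (hL : s - k ≤ L) :
    phi f n s k = ∑ l ∈ Finset.range (L + 1), ∑ h ∈ jumpHeights l (s - k), pathSum f n s h := by
  have h0 : ∑ l ∈ Finset.range (L + 1), ∑ h ∈ jumpHeights l (s - k), pathSum f n s h
      = ∑ l ∈ Finset.range (s - k + 1), ∑ h ∈ jumpHeights l (s - k), pathSum f n s h := by
    symm
    refine Finset.sum_subset (Finset.range_subset_range.2 (by omega)) fun l _ hl => ?_
    rw [jumpHeights_eq_empty (by simpa using hl), Finset.sum_empty]
  rw [h0]
  rcases eq_or_lt_of_le hk with rfl | hlt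
  · have : jumpHeights 0 0 = {Fin.elim0} := by
      ext i
      simp [mem_jumpHeights, Subsingleton.elim i Fin.elim0]
    simp [phi, this, pathSum_zero f hf]
  · have : jumpHeights 0 (s - k) = ∅ := by
      refine Finset.eq_empty_of_forall_notMem fun x hx => ?_
      rw [mem_jumpHeights] at hx
      simp at hx
      omega
    rw [phi, if_neg hlt.ne, Finset.sum_range_succ', this, Finset.sum_empty, add_zero,
      Finset.range_eq_Ico, Finset.sum_Ico_add'
      (fun l => ∑ h ∈ jumpHeights l (s - k), pathSum f n s h) 0 (s - k) 1]
    rfl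

/-- The last step of a path gives the recursion for `φ`. -/
theorem phi_succ (hf : ∀ s, f 0 s s = 1) (n : ℕ) {s k : ℕ} (hk : k ≤ s) :
    phi f (n + 1) s k = ∑ r ∈ Finset.Icc k s, f (n + 1) s r * phi f n r k := by
  -- Either no jump occurs at time `n + 1`, or one of height `a` does.
  have h1 : phi f (n + 1) s k = f (n + 1) s s * phi f n s k
      + ∑ a ∈ Finset.Icc 1 (s - k), f (n + 1) s (s - a) * phi f n (s - a) k := by
    have h2 : ∀ a ∈ Finset.Icc 1 (s - k), f (n + 1) s (s - a) * phi f n (s - a) k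
        = ∑ l ∈ Finset.range (s - k + 1), ∑ h ∈ jumpHeights l (s - k - a),
          f (n + 1) s (s - a) * pathSum f n (s - a) h := by
      intro a ha
      have := (Finset.mem_Icc.1 ha).2
      rw [phi_eq_sum_pathSum f hf n (L := s - k) (by omega) (by omega), Finset.mul_sum,
        show s - a - k = s - k - a by omega]
      simp only [Finset.mul_sum]
    -- Taking `L = s - k + 1` at level `s` and `L = s - k` after a jump makes the ranges match once
    -- the jump is removed.
    rw [Finset.sum_congr rfl h2, phi_eq_sum_pathSum f hf (n + 1) hk (Nat.le_succ _),
      phi_eq_sum_pathSum f hf n hk (Nat.le_succ _), Finset.sum_range_succ' _ (s - k + 1),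
      Finset.sum_range_succ' _ (s - k + 1)]
    simp only [sum_jumpHeights_succ, pathSum_succ_cons, pathSum_succ_zero f hf,
      Finset.sum_add_distrib, mul_add, Finset.mul_sum]
    rw [Finset.sum_comm (s := Finset.Icc 1 (s - k))]
    ring
  rw [h1, ← Finset.add_sum_Ico_eq_sum_Icc hk]
  congr 1
  refine Finset.sum_bij' (fun a _ => s - a) (fun r _ => s - r) ?_ ?_ ?_ ?_ ?_ <;>
    simp only [Finset.mem_Icc, Finset.mem_Ico, implies_true] <;> intros <;> omega

theorem phi_zero {s k : ℕ} : phi f 0 s k = if k = s then 1 else 0 := by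
  rw [phi]
  split_ifs with h
  · simp
  · refine Finset.sum_eq_zero fun l hl => Finset.sum_eq_zero fun h _ => Finset.sum_eq_zero
      fun i hi => ?_
    have := (mem_jumpTimes.1 hi).1 ⟨0, (Finset.mem_Icc.1 hl).1⟩
    omega

/-- The solution of the triangular recursion with coefficients `f`. -/
theorem eq_sum_phi_of_recursion (hf : ∀ s, f 0 s s = 1) {M : ℕ → ℕ → ℝ} {x : ℝ}
    (h0 : ∀ s, 1 ≤ s → M 0 s = x ^ s)
    (hM : ∀ n s, 1 ≤ s → M (n + 1) s = ∑ r ∈ Finset.Icc 1 s, f (n + 1) s r * M n r) (n : ℕ) :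
    ∀ s, 1 ≤ s → M n s = ∑ k ∈ Finset.Icc 1 s, phi f n s k * x ^ k := by
  induction n with
  | zero =>
    intro s hs
    rw [h0 s hs, Finset.sum_eq_single s]
    · simp [phi_zero]
    · intro k _ hk; simp [phi_zero, hk]
    · simp; omega
  | succ n ih =>
    intro s hs
    have h1 : ∀ r ∈ Finset.Icc 1 s, f (n + 1) s r * M n r
        = ∑ k ∈ Finset.Icc 1 r, f (n + 1) s r * phi f n r k * x ^ k := by
      intro r hr
      rw [ih r (Finset.mem_Icc.1 hr).1, Finset.mul_sum]
      exact Finset.sum_congr rfl fun k _ => by ring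
    rw [hM n s hs, Finset.sum_congr rfl h1]
    have h2 : ∀ k ∈ Finset.Icc 1 s, phi f (n + 1) s k * x ^ k
        = ∑ r ∈ Finset.Icc k s, f (n + 1) s r * phi f n r k * x ^ k := by
      intro k hk
      rw [phi_succ f hf n (Finset.mem_Icc.1 hk).2, Finset.sum_mul]
    rw [Finset.sum_congr rfl h2]
    refine Finset.sum_comm' fun r k => ?_
    simp only [Finset.mem_Icc]
    omega

end PathSums

/-! ### Products of rational functions and the Gamma function. -/

section GammaAsymptotics

/-- `Complex.Gamma` vanishes only at the poles of $\Gamma$, by its default value there, and `hp`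
keeps every $-\rho$ off the poles. -/
theorem gammaNegRoots_ne_zero {p : ℂ[X]} (hp : ∀ n : ℕ, p.eval (n : ℂ) ≠ 0) :
    gammaNegRoots p ≠ 0 := by
  rw [gammaNegRoots, ne_eq, Multiset.prod_eq_zero_iff, Multiset.mem_map]
  rintro ⟨ρ, hρ, h⟩
  refine Complex.Gamma_ne_zero (fun n hn => hp n ?_) h
  rw [← neg_inj.1 hn]
  exact (mem_roots'.1 hρ).2

theorem tendsto_prod_gammaSeq (p : ℂ[X]) :
    Tendsto (fun n => (p.roots.map fun ρ => Complex.GammaSeq (-ρ) n).prod) atTop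
      (𝓝 (gammaNegRoots p)) :=
  tendsto_multiset_prod _ fun ρ _ => Complex.GammaSeq_tendsto_Gamma (-ρ)

/-- Each root contributes $n^{-\rho}\,n!/\prod_{j\le n}(j-\rho)$ to the Gamma side, and $-\sum\rho$
is the subleading coefficient. -/
theorem prod_gammaSeq_mul_prod_eval {p : ℂ[X]} (hm : p.Monic) (hp : ∀ n : ℕ, p.eval (n : ℂ) ≠ 0)
    {n : ℕ} (hn : n ≠ 0) :
    (p.roots.map fun ρ => Complex.GammaSeq (-ρ) n).prod * ∏ j ∈ Finset.range (n + 1), p.eval (j : ℂ)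
      = (n : ℂ) ^ p.nextCoeff * (n.factorial : ℂ) ^ p.natDegree := by
  have hs : p.Splits := IsAlgClosed.splits p
  have hcard : p.natDegree = p.roots.card := hs.natDegree_eq_card_roots
  have hev : ∀ x : ℂ, p.eval x = (p.roots.map fun ρ => x - ρ).prod := by
    intro x
    conv_lhs => rw [hs.eq_prod_roots_of_monic hm]
    rw [eval_multiset_prod, Multiset.map_map]
    simp
  have hne : ∀ ρ ∈ p.roots, ∏ j ∈ Finset.range (n + 1), ((j : ℂ) - ρ) ≠ 0 := by
    intro ρ hρ
    rw [Finset.prod_ne_zero_iff]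
    intro j _ h
    apply hp j
    rw [sub_eq_zero.1 h]
    exact (mem_roots'.1 hρ).2
  have hn' : (n : ℂ) ≠ 0 := by exact_mod_cast hn
  have h1 : p.nextCoeff = (p.roots.map fun ρ => -ρ).sum := by
    rw [hs.nextCoeff_eq_neg_sum_roots_of_monic hm, Multiset.sum_map_neg']
  have h2 : ∀ M : Multiset ℂ, (∀ ρ ∈ M, ∏ j ∈ Finset.range (n + 1), ((j : ℂ) - ρ) ≠ 0) →
      (M.map fun ρ => Complex.GammaSeq (-ρ) n).prod
        * ∏ j ∈ Finset.range (n + 1), (M.map fun ρ => (j : ℂ) - ρ).prod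
      = (n : ℂ) ^ (M.map fun ρ => -ρ).sum * (n.factorial : ℂ) ^ M.card := by
    intro M
    induction M using Multiset.induction_on with
    | empty => intro _; simp
    | cons ρ M ih =>
      intro h
      have hM := ih fun ρ hρ => h ρ (Multiset.mem_cons_of_mem hρ)
      have h3 : Complex.GammaSeq (-ρ) n * ∏ j ∈ Finset.range (n + 1), ((j : ℂ) - ρ)
          = (n : ℂ) ^ (-ρ) * n.factorial := by
        simp only [Complex.GammaSeq, neg_add_eq_sub]
        exact div_mul_cancel₀ _ (h ρ (Multiset.mem_cons_self _ _))
      simp only [Multiset.map_cons, Multiset.prod_cons, Multiset.sum_cons, Multiset.card_cons,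
        Finset.prod_mul_distrib]
      rw [Complex.cpow_add _ _ hn', pow_succ]
      linear_combination h3 * (M.map fun ρ => Complex.GammaSeq (-ρ) n).prod
        * (∏ j ∈ Finset.range (n + 1), (M.map fun ρ => (j : ℂ) - ρ).prod)
        + (n : ℂ) ^ (-ρ) * n.factorial * hM
  rw [h1, hcard, ← h2 _ hne]
  simp only [hev]

/-- The growth of the products of a rational function over the natural numbers. -/
theorem tendsto_prod_eval_div {p q : ℂ[X]} (hpm : p.Monic) (hqm : q.Monic)
    (hd : p.natDegree = q.natDegree) (hp : ∀ n : ℕ, p.eval (n : ℂ) ≠ 0)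
    (hq : ∀ n : ℕ, q.eval (n : ℂ) ≠ 0) :
    Tendsto (fun n : ℕ => (∏ j ∈ Finset.range (n + 1), p.eval (j : ℂ) / q.eval (j : ℂ))
      / (n : ℂ) ^ (p.nextCoeff - q.nextCoeff)) atTop (𝓝 (gammaNegRoots q / gammaNegRoots p)) := by
  -- In this quotient the powers of $n!$ cancel because the degrees agree.
  have h := (tendsto_prod_gammaSeq q).div (tendsto_prod_gammaSeq p) (gammaNegRoots_ne_zero hp)
  refine h.congr' ?_
  filter_upwards [eventually_ne_atTop 0, (tendsto_prod_gammaSeq p).eventually_ne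
    (gammaNegRoots_ne_zero hp)] with n hn hpn
  have e1 := prod_gammaSeq_mul_prod_eval hpm hp hn
  have e2 := prod_gammaSeq_mul_prod_eval hqm hq hn
  have hn' : (n : ℂ) ≠ 0 := by exact_mod_cast hn
  have h3 : ∏ j ∈ Finset.range (n + 1), q.eval (j : ℂ) ≠ 0 :=
    Finset.prod_ne_zero_iff.2 fun j _ => hq j
  have h4 : (n : ℂ) ^ p.nextCoeff ≠ 0 := by simp [Complex.cpow_eq_zero_iff, hn']
  have h5 : (n : ℂ) ^ q.nextCoeff ≠ 0 := by simp [Complex.cpow_eq_zero_iff, hn']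
  rw [Finset.prod_div_distrib, Complex.cpow_sub _ _ hn']
  simp only [Pi.div_apply]
  rw [hd] at e1
  field_simp
  linear_combination e2 * (n : ℂ) ^ p.nextCoeff - (n : ℂ) ^ q.nextCoeff * e1

/-- Only the summands `l = 0` and `l = 1` reach degree `d - 1`. -/
theorem monic_sum_of_natDegree {d : ℕ} {A : ℕ → ℂ[X]} {w : ℕ → ℂ} (hd : 1 ≤ d)
    (hA : ∀ l ≤ d, (A l).Monic ∧ (A l).natDegree = d - l) (hw : w 0 = 1) :
    (∑ l ∈ Finset.range (d + 1), C (w l) * A l).Monic ∧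
    (∑ l ∈ Finset.range (d + 1), C (w l) * A l).natDegree = d ∧
    (∑ l ∈ Finset.range (d + 1), C (w l) * A l).nextCoeff = (A 0).nextCoeff + w 1 := by
  obtain ⟨e, rfl⟩ := Nat.exists_eq_add_of_le' hd
  rw [Finset.sum_range_succ']
  set r := ∑ l ∈ Finset.range (e + 1), C (w (l + 1)) * A (l + 1) with hr
  have hA0 := hA 0 (Nat.zero_le _)
  have hrd : r.natDegree ≤ e := natDegree_sum_le_of_forall_le _ _ fun l hl => by
    have := (hA (l + 1) (by have := Finset.mem_range.1 hl; omega)).2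
    exact (natDegree_C_mul_le _ _).trans (by omega)
  have hlt : r.degree < (A 0).degree := by
    rw [degree_eq_natDegree hA0.1.ne_zero, hA0.2]
    exact (degree_le_of_natDegree_le hrd).trans_lt (by exact_mod_cast Nat.lt_succ_self e)
  rw [hw, C_1, one_mul, add_comm]
  have hdeg : (A 0 + r).natDegree = e + 1 := by
    rw [natDegree_add_eq_left_of_degree_lt hlt, hA0.2]; rfl
  refine ⟨hA0.1.add_of_left hlt, hdeg, ?_⟩
  have hA1 := hA 1 (by omega)
  rw [nextCoeff_of_natDegree_pos (by omega), nextCoeff_of_natDegree_pos (by omega), hdeg, hA0.2,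
    coeff_add]
  simp only [Nat.sub_zero, Nat.add_sub_cancel]
  congr 1
  rw [hr, finsetSum_coeff, Finset.sum_eq_single 0]
  · have h1 : (A 1).coeff e = 1 := by
      have := hA1.1.coeff_natDegree
      rwa [hA1.2] at this
    simp [h1]
  · intro l hl hl0
    rw [coeff_C_mul, coeff_eq_zero_of_natDegree_lt, mul_zero]
    have hl' := Finset.mem_range.1 hl
    have := (hA (l + 1) (by omega)).2
    omega
  · simp

theorem gammaNegRoots_prod (d : ℕ) (a : ℕ → ℂ) :
    gammaNegRoots (∏ i ∈ Finset.range d, (X + C (a i)))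
      = ∏ i ∈ Finset.range d, Complex.Gamma (a i) := by
  have h : ∏ i ∈ Finset.range d, (X + C (a i)) = ∏ i ∈ Finset.range d, (X - C (-a i)) := by simp
  rw [gammaNegRoots, h, roots_prod, Multiset.map_bind, Multiset.prod_bind]
  · simp only [roots_X_sub_C, Multiset.map_singleton, neg_neg, Multiset.prod_singleton]
    rfl
  · exact Finset.prod_ne_zero_iff.2 fun i _ => X_sub_C_ne_zero _

theorem monic_prod_X_add_C (d : ℕ) (a : ℕ → ℂ) :
    (∏ i ∈ Finset.range d, (X + C (a i))).Monic ∧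
    (∏ i ∈ Finset.range d, (X + C (a i))).natDegree = d := by
  refine ⟨monic_prod_of_monic _ _ fun i _ => monic_X_add_C _, ?_⟩
  rw [natDegree_prod_of_monic _ _ fun i _ => monic_X_add_C _]
  simp

end GammaAsymptotics

/-! ### The diagonal coefficients and the growth of $\varphi_{n,s,s}$. -/

section Diagonal

variable {mod : Model} {m c σ T₀ s : ℕ}

theorem pCoeff_nonneg_self (mod : Model) (m T j : ℕ) : 0 ≤ pCoeff mod m T j j := by
  cases mod with
  | R => simp only [pCoeff]; positivity
  | M =>
    refine Finset.sum_nonneg fun h hh => ?_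
    have : h - j = 0 := by have := Finset.mem_Icc.1 hh; omega
    rw [this]
    positivity

theorem pCoeff_M_self (m T j : ℕ) : pCoeff .M m T j j = m.choose j / T.choose j := by
  rcases le_or_gt j m with h | h
  · simp [pCoeff, h, Nat.stirlingFirst_self, Nat.stirlingSecond_self]
  · simp only [pCoeff]
    rw [Finset.Icc_eq_empty (by omega), Nat.choose_eq_zero_of_lt h]
    simp

theorem pCoeff_R_self (m T j : ℕ) :
    pCoeff .R m T j j = m.choose j * j.factorial / (T : ℝ) ^ j := by
  simp only [pCoeff, Nat.stirlingSecond_self, Nat.descFactorial_eq_factorial_mul_choose]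
  push_cast
  ring

theorem fCoeff_self (hm : m ≠ 0) (hσ : σ ≠ 0) (n : ℕ) :
    fCoeff mod m c σ T₀ (n + 1) s s = ∑ j ∈ Finset.range (s + 1),
      (s.choose j : ℝ) * (c : ℝ) ^ j * pCoeff mod m (T₀ + σ * n) j j := by
  rw [fCoeff_succ mod c T₀ hm hσ, Nat.sub_self, Finset.range_eq_Ico]
  rfl

/-- The summand `j = 0` equals 1 and the others are nonnegative. Hence the diagonal products are
positive and nondecreasing in `n`. -/
theorem one_le_fCoeff_self (hm : m ≠ 0) (hσ : σ ≠ 0) (n : ℕ) :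
    1 ≤ fCoeff mod m c σ T₀ n s s := by
  cases n with
  | zero => exact (fCoeff_zero_left _ _ _ _ _ _ _).ge
  | succ n =>
    rw [fCoeff_self hm hσ, Finset.sum_range_succ']
    have h0 : pCoeff mod m (T₀ + σ * n) 0 0 = 1 := by cases mod <;> simp [pCoeff]
    have h1 : 0 ≤ ∑ j ∈ Finset.range s, (s.choose (j + 1) : ℝ) * (c : ℝ) ^ (j + 1)
        * pCoeff mod m (T₀ + σ * n) (j + 1) (j + 1) :=
      Finset.sum_nonneg fun j _ => mul_nonneg (by positivity) (pCoeff_nonneg_self _ _ _ _)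
    rw [h0]
    simpa using h1

theorem index_mul_div (hm : m ≠ 0) (hσ : σ ≠ 0) :
    ((index m c σ : ℂ) * (σ : ℂ) / (m : ℂ)) = c := by
  have hm' : (m : ℂ) ≠ 0 := by exact_mod_cast hm
  have hσ' : (σ : ℂ) ≠ 0 := by exact_mod_cast hσ
  rw [index]
  push_cast
  field_simp

theorem polyQ_eq (hm : m ≠ 0) (hσ : σ ≠ 0) :
    polyQ m c σ T₀ s = ∑ l ∈ Finset.range (s + 1),
      C ((s.choose l : ℂ) * (c : ℂ) ^ l * m.choose l * l.factorial / (σ : ℂ) ^ l)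
        * ∏ _i ∈ Finset.range (s - l), (X + C ((T₀ : ℂ) / σ)) := by
  have hσ' : (σ : ℂ) ≠ 0 := by exact_mod_cast hσ
  rw [polyQ, Finset.mul_sum]
  refine Finset.sum_congr rfl fun l hl => ?_
  obtain ⟨d, rfl⟩ := Nat.exists_eq_add_of_le (Nat.lt_succ_iff.1 (Finset.mem_range.1 hl))
  have h1 : C (σ : ℂ) * X + C (T₀ : ℂ) = C (σ : ℂ) * (X + C ((T₀ : ℂ) / σ)) := by
    rw [mul_add, ← C_mul, mul_div_cancel₀ _ hσ']
  rw [index_mul_div hm hσ, h1, Finset.prod_const, Finset.card_range, Nat.add_sub_cancel_left,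
    mul_pow, ← C_pow, ← mul_assoc, ← mul_assoc, ← C_mul, ← C_mul]
  congr 2
  rw [pow_add]
  field_simp

theorem polyP_eq (hm : m ≠ 0) (hσ : σ ≠ 0) :
    polyP m c σ T₀ s = ∑ l ∈ Finset.range (min s m + 1),
      C ((min s m).factorial / (min s m - l).factorial * ((s.choose l : ℂ) / (min s m).choose l)
          * (c : ℂ) ^ l * m.choose l / (σ : ℂ) ^ l)
        * ∏ i ∈ Finset.range (min s m - l), (X + C (((T₀ : ℂ) - l - i) / σ)) := by
  have hσ' : (σ : ℂ) ≠ 0 := by exact_mod_cast hσ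
  rw [polyP, Finset.mul_sum]
  refine Finset.sum_congr rfl fun l hl => ?_
  obtain ⟨d, hd⟩ := Nat.exists_eq_add_of_le (Nat.lt_succ_iff.1 (Finset.mem_range.1 hl))
  have h1 : ∀ i : ℕ, C (σ : ℂ) * X + C ((T₀ : ℂ) - l - i)
      = C (σ : ℂ) * (X + C (((T₀ : ℂ) - l - i) / σ)) := by
    intro i
    rw [mul_add, ← C_mul, mul_div_cancel₀ _ hσ']
  rw [index_mul_div hm hσ, binomPoly, hd, Nat.add_sub_cancel_left, Finset.prod_congr rfl
    fun i _ => h1 i, Finset.prod_mul_distrib, Finset.prod_const, Finset.card_range,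
    ← C_pow, ← mul_assoc, ← mul_assoc, ← mul_assoc, ← C_mul, ← C_mul, ← C_mul]
  congr 2
  rw [pow_add]
  field_simp

/-- The number of factors of the Gamma products. -/
def gammaCount (mod : Model) (m s : ℕ) : ℕ :=
  match mod with
  | .M => min s m
  | .R => s

/-- The arguments of the Gamma functions in the numerator of the prefactor. -/
def gammaArg (mod : Model) (σ T₀ i : ℕ) : ℂ :=
  match mod with
  | .M => ((T₀ : ℂ) - i) / σ
  | .R => (T₀ : ℂ) / σ

/-- The polynomial of the model. -/
def diagPoly (mod : Model) (m c σ T₀ s : ℕ) : ℂ[X] :=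
  match mod with
  | .M => polyP m c σ T₀ s
  | .R => polyQ m c σ T₀ s

theorem prefactor_eq : prefactor mod m c σ T₀ s
    = gammaNegRoots (∏ i ∈ Finset.range (gammaCount mod m s), (X + C (gammaArg mod σ T₀ i)))
      / gammaNegRoots (diagPoly mod m c σ T₀ s) := by
  rw [gammaNegRoots_prod]
  cases mod with
  | R => simp [prefactor, gammaCount, gammaArg, diagPoly]
  | M =>
    simp only [prefactor, gammaCount, gammaArg, diagPoly]
    congr 1
    have h := Finset.prod_Ico_add' (fun l : ℕ => Complex.Gamma (((T₀ : ℂ) + 1 - l) / σ))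
      0 (min s m) 1
    rw [Finset.range_eq_Ico]
    refine Eq.trans ?_ (h.symm.trans ?_)
    · rfl
    · refine Finset.prod_congr rfl fun i _ => ?_
      push_cast
      ring_nf

theorem prod_sub_eq_descFactorial (T d : ℕ) :
    ∏ i ∈ Finset.range d, ((T : ℂ) - i) = T.descFactorial d := by
  rw [← descPochhammer_eval_eq_descFactorial, descPochhammer_eval_eq_prod_range]

theorem eval_polyQ (hm : m ≠ 0) (hσ : σ ≠ 0) (hT : T₀ ≠ 0) (n : ℕ) :
    (polyQ m c σ T₀ s).eval (n : ℂ) = (fCoeff .R m c σ T₀ (n + 1) s s : ℂ)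
      * ∏ _i ∈ Finset.range s, ((n : ℂ) + (T₀ : ℂ) / σ) := by
  have hσ' : (σ : ℂ) ≠ 0 := by exact_mod_cast hσ
  have hT' : (T₀ : ℂ) + σ * n ≠ 0 := by exact_mod_cast (by omega : T₀ + σ * n ≠ 0)
  have h1 : (n : ℂ) + (T₀ : ℂ) / σ = (T₀ + σ * n) / σ := by field_simp; ring
  rw [polyQ_eq hm hσ, fCoeff_self hm hσ, eval_finsetSum, Complex.ofReal_sum, Finset.sum_mul]
  refine Finset.sum_congr rfl fun l hl => ?_
  obtain ⟨d, rfl⟩ := Nat.exists_eq_add_of_le (Nat.lt_succ_iff.1 (Finset.mem_range.1 hl))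
  rw [pCoeff_R_self]
  simp only [Finset.prod_const, Finset.card_range, eval_mul, eval_pow, eval_add, eval_X, eval_C,
    Nat.add_sub_cancel_left, h1, div_pow, pow_add]
  push_cast
  field_simp

/-- The product on the right is the falling factorial of $T_n$ of length $s^*$ over $\sigma^{s^*}$,
which clears all denominators $\binom{T_n}{l}$, $l\le s^*$. -/
theorem eval_polyP (hm : m ≠ 0) (hσ : σ ≠ 0) (hT : m ≤ T₀) (n : ℕ) :
    (polyP m c σ T₀ s).eval (n : ℂ) = (fCoeff .M m c σ T₀ (n + 1) s s : ℂ)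
      * ∏ i ∈ Finset.range (min s m), ((n : ℂ) + ((T₀ : ℂ) - i) / σ) := by
  have hσ' : (σ : ℂ) ≠ 0 := by exact_mod_cast hσ
  set T := T₀ + σ * n with hTdef
  have hTm : m ≤ T := hT.trans (Nat.le_add_right _ _)
  have h1 : ∀ a : ℂ, (n : ℂ) + ((T₀ : ℂ) - a) / σ = ((T : ℂ) - a) / σ := by
    intro a; rw [hTdef]; push_cast; field_simp; ring
  -- Summands with `l > m` vanish; this is where $s^*=\min\{s,m\}$ comes from.
  have hf : fCoeff .M m c σ T₀ (n + 1) s s = ∑ l ∈ Finset.range (min s m + 1),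
      (s.choose l : ℝ) * (c : ℝ) ^ l * (m.choose l / T.choose l) := by
    rw [fCoeff_self hm hσ]
    simp only [pCoeff_M_self]
    symm
    refine Finset.sum_subset (Finset.range_subset_range.2 (by omega)) fun l hl hl' => ?_
    rw [Finset.mem_range] at hl hl'
    rw [Nat.choose_eq_zero_of_lt (show m < l by omega)]
    simp
  rw [polyP_eq hm hσ, hf, eval_finsetSum, Complex.ofReal_sum, Finset.sum_mul]
  simp only [h1, Finset.prod_div_distrib, Finset.prod_const, Finset.card_range,
    prod_sub_eq_descFactorial]
  refine Finset.sum_congr rfl fun l hl => ?_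
  have hl' : l ≤ min s m := Nat.lt_succ_iff.1 (Finset.mem_range.1 hl)
  have hdT : min s m ≤ T := (min_le_right _ _).trans hTm
  generalize min s m = d at hl' hdT ⊢
  have h2 : ∏ i ∈ Finset.range (d - l), eval (n : ℂ) (X + C (((T₀ : ℂ) - l - i) / σ))
      = (T - l).descFactorial (d - l) / (σ : ℂ) ^ (d - l) := by
    rw [← prod_sub_eq_descFactorial, Nat.cast_sub (hl'.trans hdT)]
    have : ∀ i : ℕ, eval (n : ℂ) (X + C (((T₀ : ℂ) - l - i) / σ)) = ((T : ℂ) - l - i) / σ := by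
      intro i
      have := h1 (l + i)
      simp only [eval_add, eval_X, eval_C, sub_sub]
      exact this
    simp [this, Finset.prod_div_distrib]
  rw [eval_mul, eval_C, eval_prod, h2]
  have h3 : (T.choose d : ℂ) * d.choose l = T.choose l * (T - l).choose (d - l) := by
    exact_mod_cast Nat.choose_mul hl'
  have h4 : (T.choose l : ℂ) ≠ 0 := by exact_mod_cast (Nat.choose_pos (hl'.trans hdT)).ne'
  have h5 : (d.choose l : ℂ) ≠ 0 := by exact_mod_cast (Nat.choose_pos hl').ne'
  have h6 : ((d - l).factorial : ℂ) ≠ 0 := by exact_mod_cast (Nat.factorial_ne_zero _)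
  have h7 : (σ : ℂ) ^ d = (σ : ℂ) ^ l * (σ : ℂ) ^ (d - l) := by
    rw [← pow_add, Nat.add_sub_cancel' hl']
  simp only [Nat.descFactorial_eq_factorial_mul_choose, h7]
  push_cast
  field_simp
  linear_combination (-(d.factorial * s.choose l * (c : ℂ) ^ l * m.choose l)) * h3

theorem eval_diagPoly (hm : m ≠ 0) (hσ : σ ≠ 0) (hT : m ≤ T₀) (n : ℕ) :
    (diagPoly mod m c σ T₀ s).eval (n : ℂ) = (fCoeff mod m c σ T₀ (n + 1) s s : ℂ)
      * (∏ i ∈ Finset.range (gammaCount mod m s), (X + C (gammaArg mod σ T₀ i))).eval (n : ℂ) := by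
  rw [eval_prod]
  simp only [eval_add, eval_X, eval_C]
  cases mod with
  | R => exact eval_polyQ hm hσ (by omega) n
  | M => exact eval_polyP hm hσ hT n

theorem eval_gammaArg_ne_zero (hm : m ≠ 0) (hσ : σ ≠ 0) (hT : m ≤ T₀) (n : ℕ) :
    (∏ i ∈ Finset.range (gammaCount mod m s), (X + C (gammaArg mod σ T₀ i))).eval (n : ℂ) ≠ 0 := by
  rw [eval_prod, Finset.prod_ne_zero_iff]
  intro i hi
  have hσ' : (σ : ℂ) ≠ 0 := by exact_mod_cast hσ
  rw [Finset.mem_range] at hi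
  cases mod with
  | R =>
    simp only [gammaArg, eval_add, eval_X, eval_C]
    have h1 : (n : ℂ) + (T₀ : ℂ) / σ = ((n * σ + T₀ : ℕ) : ℂ) / σ := by push_cast; field_simp
    rw [h1]
    exact div_ne_zero (by exact_mod_cast (by omega : n * σ + T₀ ≠ 0)) hσ'
  | M =>
    simp only [gammaArg, gammaCount, eval_add, eval_X, eval_C] at hi ⊢
    have h1 : (n : ℂ) + ((T₀ : ℂ) - i) / σ = ((n * σ + (T₀ - i) : ℕ) : ℂ) / σ := by
      push_cast [show i ≤ T₀ by omega]; field_simp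
    rw [h1]
    exact div_ne_zero (by exact_mod_cast (by omega : n * σ + (T₀ - i) ≠ 0)) hσ'

/-- In both models the weight of the summand `l = 1` is $smc/\sigma=s\Lambda$, the growth exponent.
-/
theorem diagPoly_spec (hm : m ≠ 0) (hσ : σ ≠ 0) (hs : 1 ≤ s) :
    (diagPoly mod m c σ T₀ s).Monic ∧
    (diagPoly mod m c σ T₀ s).natDegree = gammaCount mod m s ∧
    (diagPoly mod m c σ T₀ s).nextCoeff
      = (∏ i ∈ Finset.range (gammaCount mod m s), (X + C (gammaArg mod σ T₀ i))).nextCoeff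
        + s * index m c σ := by
  cases mod with
  | R =>
    simp only [diagPoly, gammaCount, gammaArg]
    rw [polyQ_eq hm hσ]
    have h := monic_sum_of_natDegree (d := s)
      (A := fun l => ∏ _i ∈ Finset.range (s - l), (X + C ((T₀ : ℂ) / σ)))
      (w := fun l => (s.choose l : ℂ) * (c : ℂ) ^ l * m.choose l * l.factorial / (σ : ℂ) ^ l) hs
      (fun l _ => monic_prod_X_add_C (s - l) fun _ => (T₀ : ℂ) / σ) (by simp)
    refine ⟨h.1, h.2.1, h.2.2.trans ?_⟩
    simp only [index, Nat.sub_zero]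
    push_cast
    congr 1
    simp
    ring
  | M =>
    simp only [diagPoly, gammaCount, gammaArg]
    rw [polyP_eq hm hσ]
    have hd : 1 ≤ min s m := by omega
    have h := monic_sum_of_natDegree (d := min s m)
      (A := fun l => ∏ i ∈ Finset.range (min s m - l), (X + C (((T₀ : ℂ) - l - i) / σ)))
      (w := fun l => (min s m).factorial / (min s m - l).factorial
        * ((s.choose l : ℂ) / (min s m).choose l) * (c : ℂ) ^ l * m.choose l / (σ : ℂ) ^ l) hd
      (fun l _ => monic_prod_X_add_C (min s m - l) fun i => ((T₀ : ℂ) - l - i) / σ)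
      (by simp [Nat.factorial_ne_zero])
    refine ⟨h.1, h.2.1, h.2.2.trans ?_⟩
    congr 1
    · simp
    · generalize min s m = d at hd
      obtain ⟨d, rfl⟩ := Nat.exists_eq_add_of_le' hd
      have h1 : (d.factorial : ℂ) ≠ 0 := by exact_mod_cast (Nat.factorial_ne_zero _)
      have h2 : (d : ℂ) + 1 ≠ 0 := by exact_mod_cast Nat.succ_ne_zero d
      rw [index]
      simp only [Nat.add_sub_cancel, Nat.factorial_succ, Nat.choose_one_right, pow_one]
      push_cast
      field_simp

/-- The growth of the products of the diagonal coefficients. -/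
theorem exists_tendsto_phi_self (hm : m ≠ 0) (hσ : σ ≠ 0) (hT : m ≤ T₀) (hs : 1 ≤ s) :
    ∃ L : ℝ, L ≠ 0 ∧ (L : ℂ) = prefactor mod m c σ T₀ s ∧
      Tendsto (fun n : ℕ => phi (fCoeff mod m c σ T₀) n s s / (n : ℝ) ^ (s * index m c σ)) atTop
        (𝓝 L) := by
  obtain ⟨h1, h2, h3⟩ := diagPoly_spec (mod := mod) (c := c) (T₀ := T₀) hm hσ hs
  obtain ⟨hq1, hq2⟩ := monic_prod_X_add_C (gammaCount mod m s) (gammaArg mod σ T₀)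
  have hq : ∀ n : ℕ, (∏ i ∈ Finset.range (gammaCount mod m s),
      (X + C (gammaArg mod σ T₀ i))).eval (n : ℂ) ≠ 0 := fun n => eval_gammaArg_ne_zero hm hσ hT n
  have hp : ∀ n : ℕ, (diagPoly mod m c σ T₀ s).eval (n : ℂ) ≠ 0 := by
    intro n
    rw [eval_diagPoly hm hσ hT]
    refine mul_ne_zero ?_ (hq n)
    exact_mod_cast (zero_lt_one.trans_le (one_le_fCoeff_self hm hσ (n + 1))).ne'
  have h4 := tendsto_prod_eval_div h1 hq1 (h2.trans hq2.symm) hp hq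
  rw [← prefactor_eq, h3, add_sub_cancel_left] at h4
  -- Arguments $0,\dots,n$ of the polynomials correspond to times $1,\dots,n+1$.
  have h5 : ∀ n : ℕ, (∏ j ∈ Finset.range (n + 1), (diagPoly mod m c σ T₀ s).eval (j : ℂ)
      / (∏ i ∈ Finset.range (gammaCount mod m s), (X + C (gammaArg mod σ T₀ i))).eval (j : ℂ))
      / (n : ℂ) ^ ((s : ℂ) * index m c σ)
      = ((phi (fCoeff mod m c σ T₀) (n + 1) s s / (n : ℝ) ^ (s * index m c σ) : ℝ) : ℂ) := by
    intro n
    rw [phi, if_pos rfl, Complex.ofReal_div, Complex.ofReal_cpow (Nat.cast_nonneg n)]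
    push_cast
    congr 1
    have h := Finset.prod_Ico_add' (fun l : ℕ => (fCoeff mod m c σ T₀ l s s : ℂ)) 0 (n + 1) 1
    rw [Finset.range_eq_Ico]
    refine Eq.trans (Finset.prod_congr rfl fun j _ => ?_) h
    rw [eval_diagPoly hm hσ hT, mul_div_assoc, div_self (hq j), mul_one]
  rw [tendsto_congr h5] at h4
  have hre := (Complex.continuous_re.tendsto _).comp h4
  have him := (Complex.continuous_im.tendsto _).comp h4
  -- The prefactor is real as a limit of real numbers.
  have h6 : (prefactor mod m c σ T₀ s).im = 0 := by
    refine tendsto_nhds_unique him ?_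
    simp only [Function.comp_def, Complex.ofReal_im]
    exact tendsto_const_nhds
  have h7 : (((prefactor mod m c σ T₀ s).re : ℝ) : ℂ) = prefactor mod m c σ T₀ s :=
    Complex.ext rfl (by simp [h6])
  refine ⟨(prefactor mod m c σ T₀ s).re, fun h0 => ?_, h7, ?_⟩
  · rw [h0, prefactor_eq] at h7
    exact div_ne_zero (gammaNegRoots_ne_zero hq) (gammaNegRoots_ne_zero hp)
      (by simpa using h7.symm)
  · simp only [Function.comp_def, Complex.ofReal_re] at hre
    -- So far $\varphi_{n+1,s,s}$ is compared with $n^{s\Lambda}$; this factor replaces $n$ by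
    -- $n+1$.
    have h8 : Tendsto (fun n : ℕ => ((n : ℝ) / (n + 1)) ^ (s * index m c σ)) atTop (𝓝 1) := by
      have := (tendsto_natCast_div_add_atTop (1 : ℝ)).rpow_const (p := s * index m c σ)
        (Or.inl one_ne_zero)
      simpa using this
    rw [← tendsto_add_atTop_iff_nat 1]
    have h9 := hre.mul h8
    rw [mul_one] at h9
    refine h9.congr' ?_
    filter_upwards [eventually_ne_atTop 0] with n hn
    have hn' : (0 : ℝ) < n := by exact_mod_cast Nat.pos_of_ne_zero hn
    rw [Real.div_rpow hn'.le (by positivity)]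
    push_cast
    have := (Real.rpow_pos_of_pos hn' (s * index m c σ)).ne'
    field_simp

end Diagonal

/-! ### Domination and convergence of the path sums. -/

section PathBounds

variable {f : ℕ → ℕ → ℕ → ℝ}

theorem phi_self (f : ℕ → ℕ → ℕ → ℝ) (n s : ℕ) : phi f n s s = ∏ j ∈ Finset.Icc 1 n, f j s s :=
  if_pos rfl

theorem phi_self_pos (h1 : ∀ j s, 1 ≤ f j s s) (n s : ℕ) : 0 < phi f n s s := by
  rw [phi_self]
  exact Finset.prod_pos fun j _ => zero_lt_one.trans_le (h1 j s)

theorem phi_self_mul (f : ℕ → ℕ → ℕ → ℝ) (s : ℕ) {t n : ℕ} (h : t ≤ n) :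
    phi f t s s * ∏ j ∈ Finset.Icc (t + 1) n, f j s s = phi f n s s := by
  rw [phi_self, phi_self, ← Finset.Ico_add_one_right_eq_Icc, ← Finset.Ico_add_one_right_eq_Icc,
    ← Finset.Ico_add_one_right_eq_Icc]
  exact Finset.prod_Ico_consecutive _ (by omega) (by omega)

theorem phi_self_mono (h1 : ∀ j s, 1 ≤ f j s s) (s : ℕ) {t n : ℕ} (h : t ≤ n) :
    phi f t s s ≤ phi f n s s := by
  rw [← phi_self_mul f s h]
  exact le_mul_of_one_le_right (phi_self_pos h1 t s).le
    (Finset.one_le_prod fun j _ => h1 j s)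

/-- The contribution of a jump from `u` to `u - a` at time `n`. -/
def jumpWeight (f : ℕ → ℕ → ℕ → ℝ) (u a n : ℕ) : ℝ :=
  |f n u (u - a)| * phi f n (u - a) (u - a) / phi f n u u

theorem jumpWeight_nonneg (h1 : ∀ j s, 1 ≤ f j s s) (u a n : ℕ) : 0 ≤ jumpWeight f u a n :=
  div_nonneg (mul_nonneg (abs_nonneg _) (phi_self_pos h1 _ _).le) (phi_self_pos h1 _ _).le

/-- The bound separates the jump times, so their order can be ignored afterwards. Induction on the
number of jumps. -/
theorem abs_pathProd_le (h0 : ∀ s, f 0 s s = 1) (h1 : ∀ j s, 1 ≤ f j s s) :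
    ∀ {l : ℕ} (s : ℕ) (h : Fin l → ℕ) (top : ℕ) (i : Fin l → ℕ), i ∈ jumpTimes l (top - 1) →
      |pathProd f s h top i| ≤ phi f (top - 1) s s
        * ∏ ν : Fin l, jumpWeight f (s - partialHeight h ν) (h ν) (i ν)
  | 0, s, h, top, i, _ => by
    rw [pathProd_zero f h0, ← phi_self, abs_of_pos (phi_self_pos h1 _ _)]
    simp
  | l + 1, s, h, top, i, hi => by
    obtain ⟨a, h, rfl⟩ : ∃ a h', h = Fin.cons a h' :=
      ⟨h 0, Fin.tail h, (Fin.cons_self_tail h).symm⟩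
    obtain ⟨t, i, rfl⟩ : ∃ a h', i = Fin.cons a h' :=
      ⟨i 0, Fin.tail i, (Fin.cons_self_tail i).symm⟩
    obtain ⟨_, ht, hi⟩ := cons_mem_jumpTimes.1 hi
    have ih := abs_pathProd_le h0 h1 (s - a) h t i hi
    simp only [Fin.prod_univ_succ, Fin.cons_zero, Fin.cons_succ, Fin.val_zero, Fin.val_succ,
      partialHeight_zero, partialHeight_cons_succ, Nat.sub_zero]
    rw [pathProd_cons, abs_mul, abs_mul, ← phi_self_mul f s ht, jumpWeight,
      abs_of_nonneg (Finset.prod_nonneg fun j _ => zero_le_one.trans (h1 j s))]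
    have hp := phi_self_pos h1 t s
    have hpr : 0 ≤ ∏ ν : Fin l, jumpWeight f (s - a - partialHeight h ν) (h ν) (i ν) :=
      Finset.prod_nonneg fun ν _ => jumpWeight_nonneg h1 _ _ _
    -- The rest of the path is bounded with $\varphi_{t-1}$; monotonicity raises this to the
    -- $\varphi_t$ in `jumpWeight`.
    have hm := ih.trans (mul_le_mul_of_nonneg_right
      (phi_self_mono h1 (s - a) (Nat.sub_le t 1)) hpr)
    have hq : 0 ≤ |f t s (s - a)| * ∏ j ∈ Finset.Icc (t + 1) (top - 1), f j s s :=
      mul_nonneg (abs_nonneg _) (Finset.prod_nonneg fun j _ => zero_le_one.trans (h1 j s))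
    refine (mul_le_mul_of_nonneg_left hm hq).trans (le_of_eq ?_)
    simp only [Nat.sub_sub]
    field_simp

/-- The factors at level `s` after the latest jump cancel against $\varphi_{n,s,s}$, so the quotient
is independent of `n`. -/
theorem limitTerm_eq (h1 : ∀ j s, 1 ≤ f j s s) (s : ℕ) {l n : ℕ} (h : Fin (l + 1) → ℕ)
    {i : Fin (l + 1) → ℕ} (hi : i ∈ jumpTimes (l + 1) n) :
    limitTerm f s h i = pathProd f s h (n + 1) i / phi f n s s := by
  obtain ⟨a, h, rfl⟩ : ∃ a h', h = Fin.cons a h' := ⟨h 0, Fin.tail h, (Fin.cons_self_tail h).symm⟩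
  obtain ⟨t, i, rfl⟩ : ∃ a h', i = Fin.cons a h' := ⟨i 0, Fin.tail i, (Fin.cons_self_tail i).symm⟩
  obtain ⟨_, ht, _⟩ := cons_mem_jumpTimes.1 hi
  have e1 := extTimes_cons_succ 0 t i 0
  have e2 := partialHeight_cons_succ a h 0
  simp only [zero_add, extTimes_zero, partialHeight_zero, add_zero] at e1 e2
  rw [limitTerm, prod_stepFactor_cons, e1, e2, pathProd_cons, Nat.add_sub_cancel,
    ← phi_self_mul f s ht, ← phi_self]
  have hp := (phi_self_pos h1 t s).ne'
  have hq : ∏ j ∈ Finset.Icc (t + 1) n, f j s s ≠ 0 :=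
    (Finset.prod_pos fun j _ => zero_lt_one.trans_le (h1 j s)).ne'
  field_simp

theorem mem_jumpTimes_of_inf {l : ℕ} (i : JumpTimesInf l) :
    i.1 ∈ jumpTimes l (∑ ν, i.1 ν) :=
  mem_jumpTimes.2 ⟨fun a => ⟨i.2.1 a, Finset.single_le_sum (f := i.1) (fun _ _ => Nat.zero_le _)
    (Finset.mem_univ a)⟩, i.2.2⟩

theorem abs_limitTerm_le (h0 : ∀ s, f 0 s s = 1) (h1 : ∀ j s, 1 ≤ f j s s) (s : ℕ) {l : ℕ}
    (h : Fin (l + 1) → ℕ) (i : JumpTimesInf (l + 1)) :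
    |limitTerm f s h i.1|
      ≤ ∏ ν : Fin (l + 1), jumpWeight f (s - partialHeight h ν) (h ν) (i.1 ν) := by
  have hi := mem_jumpTimes_of_inf i
  have hp := phi_self_pos h1 (∑ ν, i.1 ν) s
  rw [limitTerm_eq h1 s h hi, abs_div, abs_of_pos hp, div_le_iff₀ hp, mul_comm]
  exact abs_pathProd_le h0 h1 s h _ i.1 hi

/-- A finite set of multi-indices lies in the box of its projections, over which the sum factorises.
-/
theorem summable_prod_pi {ι : Type*} [Fintype ι] {a : ι → ℕ → ℝ} (ha0 : ∀ ν n, 0 ≤ a ν n)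
    (ha : ∀ ν, Summable (a ν)) : Summable fun i : ι → ℕ => ∏ ν, a ν (i ν) := by
  classical
  refine summable_of_sum_le (c := ∏ ν, ∑' n, a ν n)
    (fun i => Finset.prod_nonneg fun ν _ => ha0 ν _) fun u => ?_
  calc ∑ i ∈ u, ∏ ν, a ν (i ν)
      ≤ ∑ i ∈ Fintype.piFinset fun ν => u.image fun i => i ν, ∏ ν, a ν (i ν) := by
        refine Finset.sum_le_sum_of_subset_of_nonneg (fun i hi => ?_)
          fun i _ _ => Finset.prod_nonneg fun ν _ => ha0 ν _
        exact Fintype.mem_piFinset.2 fun ν => Finset.mem_image_of_mem _ hi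
    _ = ∏ ν, ∑ n ∈ u.image fun i => i ν, a ν n := (Finset.prod_univ_sum _ _).symm
    _ ≤ ∏ ν, ∑' n, a ν n := Finset.prod_le_prod
        (fun ν _ => Finset.sum_nonneg fun n _ => ha0 ν n)
        fun ν _ => (ha ν).sum_le_tsum _ fun n _ => ha0 ν n

theorem partialHeight_add_le {l : ℕ} (h : Fin l → ℕ) (ν : Fin l) :
    partialHeight h ν + h ν ≤ ∑ μ, h μ := by
  rw [partialHeight, ← Finset.sum_erase_add _ _ (Finset.mem_univ ν),
    ← Finset.sum_erase_add (a := ν) Finset.univ h (Finset.mem_univ ν)]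
  simp only [lt_self_iff_false, if_false, add_zero]
  gcongr with μ
  split_ifs <;> simp

theorem summable_limitTerm (h0 : ∀ s, f 0 s s = 1) (h1 : ∀ j s, 1 ≤ f j s s)
    (hw : ∀ u a, 1 ≤ a → a < u → Summable (jumpWeight f u a)) {s k l : ℕ} (hk : 1 ≤ k)
    (hks : k ≤ s) (hl : 1 ≤ l) {h : Fin l → ℕ} (hh : h ∈ jumpHeights l (s - k)) :
    Summable fun i : JumpTimesInf l => limitTerm f s h i.1 := by
  obtain ⟨l, rfl⟩ := Nat.exists_eq_add_of_le' hl
  rw [mem_jumpHeights] at hh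
  have hs := summable_prod_pi
    (a := fun ν n => jumpWeight f (s - partialHeight h (ν : Fin (l + 1))) (h ν) n)
    (fun ν n => jumpWeight_nonneg h1 _ _ _) fun ν => by
      -- Every jump lands at a level at least `k ≥ 1`, so `hw` applies to it.
      have := partialHeight_add_le h ν
      exact hw _ _ (hh.2 ν) (by omega)
  exact Summable.of_norm_bounded (hs.comp_injective Subtype.val_injective)
    fun i => abs_limitTerm_le h0 h1 s h i

theorem tendsto_sum_jumpTimes {l : ℕ} {F : (Fin l → ℕ) → ℝ}
    (hF : Summable fun i : JumpTimesInf l => F i.1) :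
    Tendsto (fun n => ∑ i ∈ jumpTimes l n, F i) atTop (𝓝 (∑' i : JumpTimesInf l, F i.1)) := by
  classical
  let S : ℕ → Finset (JumpTimesInf l) := fun n =>
    (jumpTimes l n).subtype fun i : Fin l → ℕ => (∀ a, 1 ≤ i a) ∧ ∀ a b, a < b → i b < i a
  have hS : Tendsto S atTop atTop := by
    refine tendsto_atTop_finset_of_monotone (fun n n' h i hi => ?_) fun i => ⟨∑ ν, i.1 ν, ?_⟩
    · exact Finset.mem_subtype.2 (jumpTimes_subset h (Finset.mem_subtype.1 hi))
    · exact Finset.mem_subtype.2 (mem_jumpTimes_of_inf i)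
  refine (hF.hasSum.comp hS).congr fun n => ?_
  exact Finset.sum_subtype_of_mem F fun i hi =>
    ⟨fun a => ((mem_jumpTimes.1 hi).1 a).1, (mem_jumpTimes.1 hi).2⟩

theorem tendsto_phi_div (h0 : ∀ s, f 0 s s = 1) (h1 : ∀ j s, 1 ≤ f j s s)
    (hw : ∀ u a, 1 ≤ a → a < u → Summable (jumpWeight f u a)) {s k : ℕ} (hk : 1 ≤ k)
    (hks : k ≤ s) :
    Tendsto (fun n => phi f n s k / phi f n s s) atTop (𝓝 (phiLim f s k)) := by
  by_cases hs : k = s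
  · subst hs
    simp only [div_self (phi_self_pos h1 _ k).ne', phiLim, if_true]
    exact tendsto_const_nhds
  · rw [phiLim, if_neg hs]
    have h2 : ∀ n, phi f n s k / phi f n s s = ∑ l ∈ Finset.Icc 1 (s - k),
        ∑ h ∈ jumpHeights l (s - k), ∑ i ∈ jumpTimes l n, limitTerm f s h i := by
      intro n
      rw [phi, if_neg hs, Finset.sum_div]
      refine Finset.sum_congr rfl fun l hl => ?_
      obtain ⟨l, rfl⟩ := Nat.exists_eq_add_of_le' (Finset.mem_Icc.1 hl).1
      simp only [Finset.sum_div]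
      refine Finset.sum_congr rfl fun h _ => Finset.sum_congr rfl fun i hi => ?_
      rw [limitTerm_eq h1 s h hi, pathProd]
    simp only [h2]
    refine tendsto_finsetSum _ fun l hl => tendsto_finsetSum _ fun h hh => ?_
    exact tendsto_sum_jumpTimes
      (summable_limitTerm h0 h1 hw hk hks (Finset.mem_Icc.1 hl).1 hh)

end PathBounds

/-! ### Decay of the jump weights. -/

section Weights

variable {mod : Model} {m c σ T₀ s : ℕ}

theorem pCoeff_isBigO (hm : m ≠ 0) (hσ : σ ≠ 0) (hT : m ≤ T₀) {j : ℕ} (hj : 1 ≤ j) (l : ℕ) :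
    (fun n : ℕ => pCoeff mod m (T₀ + σ * (n - 1)) j l) =O[atTop] fun n : ℕ => ((n : ℝ))⁻¹ := by
  have hTn : ∀ n : ℕ, n ≤ σ * (n - 1) + 1 := by
    intro n
    have := Nat.mul_le_mul_right (n - 1) (Nat.one_le_iff_ne_zero.2 hσ)
    omega
  rcases Nat.eq_zero_or_pos l with rfl | hl
  · simp only [pCoeff_zero_right mod m _ hj]
    exact Asymptotics.isBigO_zero _ _
  cases mod with
  | R =>
    simp only [pCoeff, div_eq_mul_inv]
    refine Asymptotics.IsBigO.const_mul_left (Asymptotics.IsBigO.of_bound 1 ?_) _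
    filter_upwards [eventually_ge_atTop 1] with n hn
    have h1 : (n : ℝ) ≤ (T₀ + σ * (n - 1) : ℕ) ^ l := by
      have h2 : n ≤ T₀ + σ * (n - 1) := by have := hTn n; omega
      exact_mod_cast h2.trans (Nat.le_self_pow hl.ne' _)
    have hn' : (0 : ℝ) < n := by exact_mod_cast hn
    rw [one_mul, norm_inv, norm_inv, Real.norm_of_nonneg (by positivity),
      Real.norm_of_nonneg hn'.le]
    exact inv_anti₀ hn' h1
  | M =>
    simp only [pCoeff, div_eq_mul_inv]
    refine Asymptotics.IsBigO.fun_sum fun h hh => Asymptotics.IsBigO.const_mul_left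
      (Asymptotics.IsBigO.of_bound h.factorial ?_) _
    filter_upwards [eventually_ge_atTop 1] with n hn
    have hh' := Finset.mem_Icc.1 hh
    set T := T₀ + σ * (n - 1) with hTdef
    have hhm : h ≤ m := hh'.2.trans (min_le_right _ _)
    have hnT : n ≤ T + 1 - h := by have := hTn n; omega
    -- From $h!\binom Th\ge(T+1-h)^h$ with $h\ge l\ge1$, while $T_0\ge m\ge h$ gives $T+1-h\ge n$.
    have h1 : (n : ℝ) ≤ h.factorial * T.choose h := by
      have h2 := Nat.pow_le_choose (α := ℝ) h T
      have h3 : (n : ℝ) ≤ ((T + 1 - h : ℕ) : ℝ) ^ h := by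
        exact_mod_cast hnT.trans (Nat.le_self_pow (by omega) _)
      rw [div_le_iff₀ (by positivity)] at h2
      linarith
    have hn' : (0 : ℝ) < n := by exact_mod_cast hn
    have hc : (0 : ℝ) < T.choose h := by exact_mod_cast Nat.choose_pos (by omega)
    rw [norm_inv, norm_inv, Real.norm_of_nonneg hc.le, Real.norm_of_nonneg hn'.le,
      ← div_eq_mul_inv, inv_eq_one_div, div_le_div_iff₀ hc hn', one_mul]
    exact h1

/-- Off the diagonal every summand has $j\ge u-r\ge1$, so the constant 1 of the diagonal is absent.
-/
theorem fCoeff_isBigO (hm : m ≠ 0) (hσ : σ ≠ 0) (hT : m ≤ T₀) {u r : ℕ} (hr : r < u) :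
    (fun n : ℕ => fCoeff mod m c σ T₀ n u r) =O[atTop] fun n : ℕ => ((n : ℝ))⁻¹ := by
  have h : (fun n : ℕ => ∑ j ∈ Finset.Icc (u - r) u,
      (u.choose j : ℝ) * (index m c σ ^ j * (σ : ℝ) ^ j / (m : ℝ) ^ j)
        * pCoeff mod m (T₀ + σ * (n - 1)) j (j - (u - r))) =O[atTop] fun n : ℕ => ((n : ℝ))⁻¹ :=
    Asymptotics.IsBigO.fun_sum fun j hj => (pCoeff_isBigO hm hσ hT
      (by have := (Finset.mem_Icc.1 hj).1; omega) _).const_mul_left _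
  refine h.congr' ?_ EventuallyEq.rfl
  filter_upwards [eventually_ne_atTop 0] with n hn
  rw [fCoeff, if_neg hn]

/-- The jump coefficient is $O(n^{-1})$ and the quotient of diagonal products is $O(n^{-a\Lambda})$,
with $a\Lambda>0$. -/
theorem summable_jumpWeight (hm : m ≠ 0) (hc : c ≠ 0) (hσ : σ ≠ 0) (hT : m ≤ T₀) (u a : ℕ)
    (ha : 1 ≤ a) (hau : a < u) : Summable (jumpWeight (fCoeff mod m c σ T₀) u a) := by
  obtain ⟨L, hL, _, hLt⟩ := exists_tendsto_phi_self (mod := mod) (c := c) (s := u) hm hσ hT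
    (by omega)
  obtain ⟨L', _, _, hLt'⟩ := exists_tendsto_phi_self (mod := mod) (c := c) (s := u - a) hm hσ hT
    (by omega)
  have hΛ : 0 < index m c σ := by rw [index]; positivity
  have hr := ((hLt'.div hLt hL).isBigO_one ℝ)
  have hf := (fCoeff_isBigO (mod := mod) (c := c) hm hσ hT (show u - a < u by omega)).norm_left
  have hpow : (fun n : ℕ => (n : ℝ) ^ (-(a * index m c σ))) =O[atTop]
      fun n : ℕ => (n : ℝ) ^ (-(a * index m c σ)) := Asymptotics.isBigO_refl _ _
  have hall := (hf.mul hr).mul hpow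
  refine summable_of_isBigO_nat (Real.summable_nat_rpow.2
    (show -1 - a * index m c σ < -1 by
      have : 0 < (a : ℝ) * index m c σ := by positivity
      linarith)) (hall.congr' ?_ ?_)
  · filter_upwards [eventually_ne_atTop 0] with n hn
    have hn' : (0 : ℝ) < n := by exact_mod_cast Nat.pos_of_ne_zero hn
    have hp := (phi_self_pos (f := fCoeff mod m c σ T₀)
      (fun j s => one_le_fCoeff_self hm hσ j) n u).ne'
    have h1 := (Real.rpow_pos_of_pos hn' (a * index m c σ)).ne'
    have h2 := (Real.rpow_pos_of_pos hn' ((u - a : ℕ) * index m c σ)).ne'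
    have h3 : (n : ℝ) ^ (u * index m c σ)
        = (n : ℝ) ^ ((u - a : ℕ) * index m c σ) * (n : ℝ) ^ (a * index m c σ) := by
      rw [← Real.rpow_add hn', Nat.cast_sub hau.le]
      ring_nf
    simp only [jumpWeight, Pi.div_apply, Real.norm_eq_abs, h3, Real.rpow_neg hn'.le]
    field_simp
  · filter_upwards [eventually_ne_atTop 0] with n hn
    have hn' : (0 : ℝ) < n := by exact_mod_cast Nat.pos_of_ne_zero hn
    rw [mul_one, sub_eq_add_neg, Real.rpow_add hn', Real.rpow_neg_one]

end Weights

end TriangularUrn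

end

/-! ### Moments and limits of the urn. -/

theorem mainTheorem3
    (mod : TriangularUrn.Model) (m c σ W₀ B₀ : ℕ)
    (hm : 1 ≤ m) (hc : 0 < c) (hσ : m * c ≤ σ) (hT₀ : m ≤ W₀ + B₀)
    {Ω : Type*} [MeasurableSpace Ω] (P : Measure Ω) [IsProbabilityMeasure P]
    (X : ℕ → Ω → Fin (m + 1))
    (hX : TriangularUrn.IsUrnProcess mod c σ W₀ B₀ P X)
    (s : ℕ) (hs : 1 ≤ s) :
    -- the moments of `W_n`
    (∀ n : ℕ,
      Integrable (fun ω => (TriangularUrn.whiteBalls c W₀ X n ω : ℝ) ^ s) P ∧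
      ∫ ω, (TriangularUrn.whiteBalls c W₀ X n ω : ℝ) ^ s ∂P
        = ∑ k ∈ Finset.Icc 1 s,
            TriangularUrn.phi (TriangularUrn.fCoeff mod m c σ (W₀ + B₀)) n s k * (W₀ : ℝ) ^ k) ∧
    -- the infinite sums converge
    (∀ k ∈ Finset.Icc 1 (s - 1), ∀ l ∈ Finset.Icc 1 (s - k),
      ∀ h ∈ TriangularUrn.jumpHeights l (s - k),
        Summable fun i : TriangularUrn.JumpTimesInf l =>
          TriangularUrn.limitTerm (TriangularUrn.fCoeff mod m c σ (W₀ + B₀)) s h i.1) ∧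
    -- `φ̃_{s,k}` is the limit of `φ_{n,s,k} / φ_{n,s,s}`
    (∀ k ∈ Finset.Icc 1 s,
      Tendsto
        (fun n : ℕ => TriangularUrn.phi (TriangularUrn.fCoeff mod m c σ (W₀ + B₀)) n s k
          / TriangularUrn.phi (TriangularUrn.fCoeff mod m c σ (W₀ + B₀)) n s s)
        atTop (𝓝 (TriangularUrn.phiLim (TriangularUrn.fCoeff mod m c σ (W₀ + B₀)) s k))) ∧
    -- the limits `E_s`
    ∃ E : ℝ,
      Tendsto
        (fun n : ℕ => ∫ ω, ((TriangularUrn.whiteBalls c W₀ X n ω : ℝ)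
          / (n : ℝ) ^ TriangularUrn.index m c σ) ^ s ∂P)
        atTop (𝓝 E) ∧
      (E : ℂ) = TriangularUrn.prefactor mod m c σ (W₀ + B₀) s
        * ∑ k ∈ Finset.Icc 1 s,
            (TriangularUrn.phiLim (TriangularUrn.fCoeff mod m c σ (W₀ + B₀)) s k : ℂ)
              * (W₀ : ℂ) ^ k := by
  have hm0 : m ≠ 0 := by omega
  have hσ0 : σ ≠ 0 := by
    have : 0 < m * c := Nat.mul_pos (by omega) hc
    omega
  set f := TriangularUrn.fCoeff mod m c σ (W₀ + B₀) with hf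
  have h0 : ∀ s, f 0 s s = 1 := fun s => TriangularUrn.fCoeff_zero_left _ _ _ _ _ _ _
  have h1 : ∀ j s, 1 ≤ f j s s := fun j s => TriangularUrn.one_le_fCoeff_self hm0 hσ0 j
  have hw : ∀ u a, 1 ≤ a → a < u → Summable (TriangularUrn.jumpWeight f u a) :=
    TriangularUrn.summable_jumpWeight hm0 hc.ne' hσ0 hT₀
  have hmom : ∀ n : ℕ, ∫ ω, (TriangularUrn.whiteBalls c W₀ X n ω : ℝ) ^ s ∂P
      = ∑ k ∈ Finset.Icc 1 s, TriangularUrn.phi f n s k * (W₀ : ℝ) ^ k := fun n =>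
    TriangularUrn.eq_sum_phi_of_recursion f h0
      (M := fun n s => ∫ ω, (TriangularUrn.whiteBalls c W₀ X n ω : ℝ) ^ s ∂P)
      (fun s _ => by simp [TriangularUrn.whiteBalls])
      (fun n s hs => hX.moment_succ hm hσ0 hσ hT₀ n hs) n s hs
  have hlim : ∀ k ∈ Finset.Icc 1 s, Tendsto
      (fun n : ℕ => TriangularUrn.phi f n s k / TriangularUrn.phi f n s s)
      atTop (𝓝 (TriangularUrn.phiLim f s k)) := fun k hk =>
    TriangularUrn.tendsto_phi_div h0 h1 hw (Finset.mem_Icc.1 hk).1 (Finset.mem_Icc.1 hk).2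
  refine ⟨fun n => ⟨hX.integrable_comp n fun w => (w : ℝ) ^ s, hmom n⟩, ?_, hlim, ?_⟩
  · intro k hk l hl h hh
    rw [Finset.mem_Icc] at hk
    exact TriangularUrn.summable_limitTerm h0 h1 hw hk.1 (by omega) (Finset.mem_Icc.1 hl).1 hh
  · obtain ⟨L, _, hL, hLt⟩ :=
      TriangularUrn.exists_tendsto_phi_self (mod := mod) (c := c) hm0 hσ0 hT₀ hs
    refine ⟨L * ∑ k ∈ Finset.Icc 1 s, TriangularUrn.phiLim f s k * (W₀ : ℝ) ^ k, ?_, ?_⟩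
    · have hsum := tendsto_finsetSum (Finset.Icc 1 s) fun k hk =>
        (hlim k hk).mul_const ((W₀ : ℝ) ^ k)
      -- $\varphi_{n,s,s}$ cancels between the two factors, and $(n^\Lambda)^s=n^{s\Lambda}$.
      refine (hLt.mul hsum).congr fun n => ?_
      have hp := (TriangularUrn.phi_self_pos h1 n s).ne'
      simp only [div_pow]
      rw [integral_div, hmom n, ← Real.rpow_mul_natCast (Nat.cast_nonneg n), mul_comm (s : ℝ),
        div_mul_eq_mul_div, Finset.mul_sum]
      congr 1
      refine Finset.sum_congr rfl fun k _ => ?_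
      rw [← mul_assoc, mul_div_cancel₀ _ hp]
    · rw [← hL]
      push_cast
      rfl
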